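/- \textbf{Lemma.} Let $a\in\mathbb{R}$ and $\sigma_0,\sigma_v\ge 0$, and consider the scalar system $$x[n+1]=a\,x[n]+u[n]+w[n],\qquad y[n]=x[n]+v[n],\qquad n\ge 0,$$ where $x[0]\sim\mathcal N(0,\sigma_0^2)$, $w[n]\sim\mathcal N(0,1)$, $v[n]\sim\mathcal N(0,\sigma_v^2)$ are mutually independent. A causal control strategy is a sequence of measurable functions $f_n$ with $u[n]=f_n(y[0],\dots,y[n])$. It achieves the pair $(D,P)$ (state distortion, input power) if $$\limsup_{N\to\infty}\frac1N\sum_{n=1}^N\mathbb E[x^2[n]]\le D,\qquad \limsup_{N\to\infty}\frac1N\sum_{n=1}^N\mathbb E[u^2[n]]\le P.$$ Put $$\Sigma_E=\frac{(a^2-1)\sigma_v^2-1+\sqrt{((a^2-1)\sigma_v^2-1)^2+4a^2\sigma_v^2}}{2a^2}\quad(a\ne0),\qquad \Sigma_E=\frac{\sigma_v^2}{\sigma_v^2+1}\quad(a=0),$$ and, for $k\in\mathbb{R}$ with $|a-k|<1$, $$D_k=\frac{(2ak-k^2)\Sigma_E+1}{1-(a-k)^2},\qquad P_k=k^2\,(D_k-\Sigma_E).$$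 Let $\hat x[n]=\mathbb E[x[n]\mid y[0],\dots,y[n],u[0],\dots,u[n-1]]$. Then: (i) $\Sigma_E\ge0$ and $a^2\Sigma_E^2=((a^2-1)\sigma_v^2-1)\Sigma_E+\sigma_v^2$. (ii) For every $k$ with $|a-k|<1$ there is a causal strategy satisfying $u[n]=-k\hat x[n]$ almost surely for all $n$; and every such strategy satisfies $\lim_{n\to\infty}\mathbb E[(x[n]-\hat x[n])^2]=\Sigma_E$ and achieves the pair $(D_k,P_k)$. (iii) This tradeoff curve is optimal among all causal strategies: if some causal strategy achieves $(D,P)$ with $0\le D,P<\infty$, then there is $k$ with $|a-k|<1$, $D_k\le D$ and $P_k\le P$. (iv) In particular, if $|a-k|<1$, $|k|\le|a|$ and $ak\ge\max(0,a^2-1)$, then every causal strategy with $\limsup_{N}\frac1N\sum_{n=1}^N\mathbb E[u^2[n]]\le P_k$ has $\limsup_{N}\frac1N\sum_{n=1}^N\mathbb E[x^2[n]]\ge D_k$. -/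

import Mathlib

open MeasureTheory ProbabilityTheory Filter Topology
open scoped NNReal ENNReal

namespace ScalarLQG

/-- The primitive random variables: `x₀ ∼ 𝒩(0, σ₀²)`, `w n ∼ 𝒩(0, 1)`, `v n ∼ 𝒩(0, σᵥ²)`,
all mutually independent. A Gaussian of variance `0` is the constant `0`. -/
structure IsNoise {Ω : Type*} [MeasurableSpace Ω] (μ : Measure Ω) (σ₀ σᵥ : ℝ≥0)
    (x₀ : Ω → ℝ) (w v : ℕ → Ω → ℝ) : Prop where
  measurable_init : Measurable x₀
  measurable_process : ∀ n, Measurable (w n)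
  measurable_obs : ∀ n, Measurable (v n)
  law_init : μ.map x₀ = gaussianReal 0 (σ₀ ^ 2)
  law_process : ∀ n, μ.map (w n) = gaussianReal 0 1
  law_obs : ∀ n, μ.map (v n) = gaussianReal 0 (σᵥ ^ 2)
  indep : iIndepFun (Sum.elim (fun _ : Unit => x₀) (Sum.elim w v)) μ

/-- A causal control strategy: at time `n` the control is a measurable function of the
observations at times `0, …, n`. -/
structure CausalStrategy where
  law : (n : ℕ) → (Fin (n + 1) → ℝ) → ℝ
  measurable_law : ∀ n, Measurable (law n)

/-- The closed loop run on one sample of the noise: the pair of the state at time `n` and of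
the observations at times `0, …, n`. -/
def closedLoop (a : ℝ) (f : CausalStrategy) (x₀ : ℝ) (w v : ℕ → ℝ) :
    (n : ℕ) → ℝ × (Fin (n + 1) → ℝ)
  | 0 => (x₀, fun _ => x₀ + v 0)
  | n + 1 =>
    let p := closedLoop a f x₀ w v n
    let x := a * p.1 + f.law n p.2 + w n
    (x, Fin.snoc (α := fun _ => ℝ) p.2 (x + v (n + 1)))

section Processes

variable {Ω : Type*} (a : ℝ) (f : CausalStrategy) (x₀ : Ω → ℝ) (w v : ℕ → Ω → ℝ)

/-- The state process `x[n]`. -/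
def state (n : ℕ) (ω : Ω) : ℝ :=
  (closedLoop a f (x₀ ω) (fun i => w i ω) (fun i => v i ω) n).1

/-- The observation process `y[n] = x[n] + v[n]`. -/
def obs (n : ℕ) (ω : Ω) : ℝ := state a f x₀ w v n ω + v n ω

/-- The control process `u[n] = fₙ(y[0], …, y[n])`. -/
def control (n : ℕ) (ω : Ω) : ℝ := f.law n fun i => obs a f x₀ w v i ω

/-- The observations recorded by the closed loop are the values of `obs`. -/
theorem closedLoop_snd (n : ℕ) (ω : Ω) (i : Fin (n + 1)) :
    (closedLoop a f (x₀ ω) (fun i => w i ω) (fun i => v i ω) n).2 i = obs a f x₀ w v i ω := by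
  induction n with
  | zero =>
    obtain rfl : i = 0 := Fin.fin_one_eq_zero i
    rfl
  | succ n ih =>
    refine Fin.lastCases ?_ (fun j => ?_) i
    · simp [closedLoop, obs, state]
    · simpa [closedLoop] using ih j

theorem state_zero : state a f x₀ w v 0 = x₀ := rfl

/-- The dynamics `x[n+1] = a x[n] + u[n] + w[n]`. -/
theorem state_succ (n : ℕ) (ω : Ω) :
    state a f x₀ w v (n + 1) ω =
      a * state a f x₀ w v n ω + control a f x₀ w v n ω + w n ω := by
  have h : (closedLoop a f (x₀ ω) (fun i => w i ω) (fun i => v i ω) n).2 =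
      fun i : Fin (n + 1) => obs a f x₀ w v i ω :=
    funext fun i => closedLoop_snd a f x₀ w v n ω i
  simp [state, control, closedLoop, h]

/-- The information `σ(y[0], …, y[n], u[0], …, u[n-1])` at time `n`. -/
@[reducible]
def info (n : ℕ) : MeasurableSpace Ω :=
  (⨆ i ∈ Finset.range (n + 1), MeasurableSpace.comap (obs a f x₀ w v i) inferInstance) ⊔
    ⨆ i ∈ Finset.range n, MeasurableSpace.comap (control a f x₀ w v i) inferInstance

/-- The estimate `x̂[n] = 𝔼[x[n] | y[0], …, y[n], u[0], …, u[n-1]]`. -/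
noncomputable def estimate [MeasurableSpace Ω] (μ : Measure Ω) (n : ℕ) : Ω → ℝ :=
  μ[state a f x₀ w v n | info a f x₀ w v n]

/-- The strategy is the linear strategy `u[n] = -k x̂[n]`. -/
def IsLinearStrategy [MeasurableSpace Ω] (μ : Measure Ω) (k : ℝ) : Prop :=
  ∀ n, control a f x₀ w v n =ᵐ[μ] fun ω => -k * estimate a f x₀ w v μ n ω

end Processes

/-- The second moment `𝔼[z²]`, possibly infinite. -/
noncomputable def secondMoment {Ω : Type*} [MeasurableSpace Ω] (μ : Measure Ω)
    (z : Ω → ℝ) : ℝ≥0∞ :=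
  ∫⁻ ω, ENNReal.ofReal (z ω ^ 2) ∂μ

/-- The long-term average `limsup_N (1/N) ∑_{n=1}^N 𝔼[z[n]²]`. -/
noncomputable def averageCost {Ω : Type*} [MeasurableSpace Ω] (μ : Measure Ω)
    (z : ℕ → Ω → ℝ) : ℝ≥0∞ :=
  limsup (fun N : ℕ => (∑ n ∈ Finset.Icc 1 N, secondMoment μ (z n)) / (N : ℝ≥0∞)) atTop

/-- The strategy `f` achieves state distortion `D` with input power `P`. -/
def Achieves {Ω : Type*} [MeasurableSpace Ω] (μ : Measure Ω) (a : ℝ) (f : CausalStrategy)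
    (x₀ : Ω → ℝ) (w v : ℕ → Ω → ℝ) (D P : ℝ≥0∞) : Prop :=
  averageCost μ (state a f x₀ w v) ≤ D ∧ averageCost μ (control a f x₀ w v) ≤ P

/-- The steady-state Kalman error. For `a = 0`, where the closed formula is `0 / 0`, it is the
limit `σᵥ² / (σᵥ² + 1)` of that formula. -/
noncomputable def kalmanError (a σᵥ : ℝ) : ℝ :=
  if a = 0 then σᵥ ^ 2 / (σᵥ ^ 2 + 1)
  else ((a ^ 2 - 1) * σᵥ ^ 2 - 1 +
    √(((a ^ 2 - 1) * σᵥ ^ 2 - 1) ^ 2 + 4 * a ^ 2 * σᵥ ^ 2)) / (2 * a ^ 2)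

/-- The distortion of the linear strategy with gain `k`. -/
noncomputable def linDistortion (a σᵥ k : ℝ) : ℝ :=
  ((2 * a * k - k ^ 2) * kalmanError a σᵥ + 1) / (1 - (a - k) ^ 2)

/-- The power of the linear strategy with gain `k`. -/
noncomputable def linPower (a σᵥ k : ℝ) : ℝ :=
  k ^ 2 * (linDistortion a σᵥ k - kalmanError a σᵥ)

end ScalarLQG

/-!
The estimation error does not see the control. Running the Kalman filter in innovation form along
an arbitrary causal strategy, the error `err n` and the innovations `innov n` are linear
combinations of the primitive random variables with coefficients that do not involve the strategy.
They are jointly Gaussian, and `err n` and `innov (n + 1)` are uncorrelated with the innovations up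
to time `n`, hence independent of the σ-algebra `innovInfo n` they generate
(`IsNoise.cov_err_innov`, `IsNoise.indep_innovInfo`). The observations and controls up to time `n`
are measurable for `innovInfo n`, and so is the filter output `ξ[n] = x[n] - err n`
(`kalmanFilter`). No moment assumption on the strategy enters so far, and two exact identities in
`[0, ∞]` follow (`IsNoise.secondMoment_state`, `IsNoise.secondMoment_kalmanFilter_succ`):

* `𝔼 x[n]² = errVar n + 𝔼 ξ[n]²`,
* `𝔼 ξ[n+1]² = 𝔼 (a ξ[n] + u[n])² + qₙ`, where `qₙ = predVar (n + 1) - errVar (n + 1)`.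

The error variance follows the Riccati recursion, which contracts to `Σ = kalmanError a σᵥ`
(`tendsto_errVar`), so `qₙ → q = a² Σ + 1 - Σ > 0`. In these terms the linear strategy with gain
`k` has distortion `Σ + X` and power `k² X` with `X = q / (1 - (a - k)²)`.

If `u = -k x̂`, an induction shows that the state stays square integrable, so that `x̂ = ξ` almost
surely and `𝔼 ξ[n+1]² = (a - k)² 𝔼 ξ[n]² + qₙ`, whose limit is `X`. This gives achievability.

For the converse, `𝔼 (a ξ + u)² ≥ (1 - t) a² 𝔼 ξ² + (1 - 1 / t) 𝔼 u²` for every `t > 0`. These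
bounds are linear in the moments, so they may be averaged over time. Finite average distortion
prevents `𝔼 ξ[N]²` from growing linearly, so along a subsequence the boundary term of the average
vanishes and the averages converge (`exists_stationary`). The limit `(X, U)` satisfies
`X ≥ (1 - t) a² X + (1 - 1 / t) U + q` for all `t > 0`; optimizing over `t` gives
`X ≥ (|a| √X - √U)² + q`, which says that the gain `k = ± √(U / X)`, with the sign of `a`, is at
least as good (`exists_gain_of_stationary`). Along the efficient branch the power of a linear
strategy is strictly decreasing in its distortion (`power_lt_of_pos`), which yields the last claim.
-/

namespace ScalarLQG

/-! ### The steady-state error -/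

theorem kalmanError_nonneg (a s : ℝ) : 0 ≤ kalmanError a s := by
  unfold kalmanError
  split_ifs with h
  · positivity
  · refine div_nonneg ?_ (by positivity)
    have : |(a ^ 2 - 1) * s ^ 2 - 1| ≤
        √(((a ^ 2 - 1) * s ^ 2 - 1) ^ 2 + 4 * a ^ 2 * s ^ 2) :=
      Real.abs_le_sqrt (by nlinarith [sq_nonneg (a * s)])
    linarith [neg_abs_le ((a ^ 2 - 1) * s ^ 2 - 1)]

theorem kalmanError_riccati (a s : ℝ) :
    a ^ 2 * kalmanError a s ^ 2 =
      ((a ^ 2 - 1) * s ^ 2 - 1) * kalmanError a s + s ^ 2 := by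
  unfold kalmanError
  split_ifs with h
  · subst h
    have : s ^ 2 + 1 ≠ 0 := by positivity
    field_simp
    ring
  · have hs := Real.sq_sqrt (x := ((a ^ 2 - 1) * s ^ 2 - 1) ^ 2 + 4 * a ^ 2 * s ^ 2)
      (by positivity)
    set R := √(((a ^ 2 - 1) * s ^ 2 - 1) ^ 2 + 4 * a ^ 2 * s ^ 2)
    field_simp
    linear_combination hs

/-- The increase `a² Σ + 1 - Σ` of the second moment of the estimate caused by one new
observation, in the steady state `Σ = kalmanError a s`. -/
noncomputable def steadyGain (a s : ℝ) : ℝ := a ^ 2 * kalmanError a s + 1 - kalmanError a s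

theorem steadyGain_pos (a s : ℝ) : 0 < steadyGain a s := by
  have h0 := kalmanError_nonneg a s
  have h1 := kalmanError_riccati a s
  unfold steadyGain
  set K := kalmanError a s
  have hM : 0 < a ^ 2 * K + 1 := by positivity
  have : (a ^ 2 * K + 1 - K) * (a ^ 2 * K + 1 + s ^ 2) = (a ^ 2 * K + 1) ^ 2 := by
    linear_combination -h1
  refine pos_of_mul_pos_left (b := a ^ 2 * K + 1 + s ^ 2) ?_ (by positivity)
  rw [this]
  positivity

theorem linDistortion_eq {a k : ℝ} (s : ℝ) (hk : |a - k| < 1) :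
    linDistortion a s k = kalmanError a s + steadyGain a s / (1 - (a - k) ^ 2) := by
  have : 1 - (a - k) ^ 2 ≠ 0 := by
    have := (sq_lt_one_iff_abs_lt_one _).2 hk
    linarith
  unfold linDistortion steadyGain
  field_simp
  ring

theorem linPower_eq {a k : ℝ} (s : ℝ) (hk : |a - k| < 1) :
    linPower a s k = k ^ 2 * (steadyGain a s / (1 - (a - k) ^ 2)) := by
  rw [linPower, linDistortion_eq s hk, add_sub_cancel_left]

theorem linPower_nonneg {a k : ℝ} (s : ℝ) (hk : |a - k| < 1) : 0 ≤ linPower a s k := by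
  rw [linPower_eq s hk]
  have h1 := (sq_lt_one_iff_abs_lt_one _).2 hk
  exact mul_nonneg (sq_nonneg k) (div_nonneg (steadyGain_pos a s).le (by linarith))

/-! ### The Riccati recursion -/

/-- The variance of the error of the one-step prediction of the state, for initial variance `s₀`
and observation noise of variance `r`. -/
noncomputable def predVar (a s₀ r : ℝ) : ℕ → ℝ
  | 0 => s₀
  | n + 1 => a ^ 2 * (predVar a s₀ r n * r / (predVar a s₀ r n + r)) + 1

/-- The variance of the error of the estimate of the state. -/
noncomputable def errVar (a s₀ r : ℝ) (n : ℕ) : ℝ :=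
  predVar a s₀ r n * r / (predVar a s₀ r n + r)

/-- The Kalman gain. If both variances vanish it is `0 / 0 = 0`: there is nothing to correct. -/
noncomputable def gain (a s₀ r : ℝ) (n : ℕ) : ℝ := predVar a s₀ r n / (predVar a s₀ r n + r)

section Riccati

variable {a s₀ r : ℝ}

theorem predVar_succ (n : ℕ) : predVar a s₀ r (n + 1) = a ^ 2 * errVar a s₀ r n + 1 := rfl

theorem predVar_nonneg (h₀ : 0 ≤ s₀) (hr : 0 ≤ r) (n : ℕ) : 0 ≤ predVar a s₀ r n := by
  induction n with
  | zero => exact h₀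
  | succ n ih => unfold predVar; positivity

theorem errVar_nonneg (h₀ : 0 ≤ s₀) (hr : 0 ≤ r) (n : ℕ) : 0 ≤ errVar a s₀ r n := by
  have := predVar_nonneg (a := a) h₀ hr n
  unfold errVar
  positivity

theorem gain_mul_add (h₀ : 0 ≤ s₀) (hr : 0 ≤ r) (n : ℕ) :
    gain a s₀ r n * (predVar a s₀ r n + r) = predVar a s₀ r n := by
  have := predVar_nonneg (a := a) h₀ hr n
  exact div_mul_cancel_of_imp fun h => by linarith

theorem errVar_eq (h₀ : 0 ≤ s₀) (hr : 0 ≤ r) (n : ℕ) :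
    errVar a s₀ r n = (1 - gain a s₀ r n) * predVar a s₀ r n := by
  have h : errVar a s₀ r n = gain a s₀ r n * r := by unfold errVar gain; ring
  linear_combination h + gain_mul_add (a := a) h₀ hr n

/-- A sequence that contracts up to a vanishing perturbation tends to `0`. -/
theorem tendsto_zero_of_le_mul_add {δ η : ℕ → ℝ} {ρ : ℝ} (hδ : ∀ n, 0 ≤ δ n) (hρ₀ : 0 ≤ ρ)
    (hρ : ρ < 1) (h : ∀ n, δ (n + 1) ≤ ρ * δ n + η n) (hη : Tendsto η atTop (𝓝 0)) :
    Tendsto δ atTop (𝓝 0) := by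
  rw [Metric.tendsto_atTop]
  intro ε hε
  have h1 : 0 < ε / 2 * (1 - ρ) := mul_pos (half_pos hε) (by linarith)
  obtain ⟨N, hN⟩ := eventually_atTop.1 (hη.eventually_le_const h1)
  have hm : ∀ m, δ (N + m) ≤ ρ ^ m * δ N + ε / 2 := by
    intro m
    induction m with
    | zero => simp; linarith
    | succ m ih =>
      have h2 := h (N + m)
      have h3 := hN (N + m) (by omega)
      have h4 := mul_le_mul_of_nonneg_left ih hρ₀
      rw [← add_assoc, pow_succ]
      linarith
  have h5 : Tendsto (fun m => ρ ^ m * δ N) atTop (𝓝 0) := by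
    simpa using (tendsto_pow_atTop_nhds_zero_of_lt_one hρ₀ hρ).mul_const (δ N)
  obtain ⟨M, hM⟩ := eventually_atTop.1 (h5.eventually_lt_const (half_pos hε))
  refine ⟨N + M, fun n hn => ?_⟩
  obtain ⟨m, rfl⟩ := Nat.exists_eq_add_of_le (show N ≤ n by omega)
  rw [Real.dist_eq, sub_zero, abs_of_nonneg (hδ _)]
  linarith [hm m, hM m (by omega)]

theorem tendsto_of_eq_mul_add {X q : ℕ → ℝ} {ρ q' : ℝ} (hρ₀ : 0 ≤ ρ) (hρ : ρ < 1)
    (h : ∀ n, X (n + 1) = ρ * X n + q n) (hq : Tendsto q atTop (𝓝 q')) :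
    Tendsto X atTop (𝓝 (q' / (1 - ρ))) := by
  have h1 : 1 - ρ ≠ 0 := by linarith
  rw [tendsto_iff_dist_tendsto_zero] at hq ⊢
  refine tendsto_zero_of_le_mul_add (fun _ => dist_nonneg) hρ₀ hρ (fun n => ?_) hq
  have h2 : X (n + 1) - q' / (1 - ρ) = ρ * (X n - q' / (1 - ρ)) + (q n - q') := by
    rw [h]
    field_simp
    ring
  rw [Real.dist_eq, Real.dist_eq, Real.dist_eq, h2]
  refine (abs_add_le _ _).trans_eq ?_
  rw [abs_mul, abs_of_nonneg hρ₀]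

/-- The Riccati recursion contracts towards its fixed point with the ratio `s² / (1 + s²)`. -/
theorem tendsto_errVar (a s : ℝ) (h₀ : 0 ≤ s₀) :
    Tendsto (errVar a s₀ (s ^ 2)) atTop (𝓝 (kalmanError a s)) := by
  have h1 := kalmanError_riccati a s
  have hK := kalmanError_nonneg a s
  have hr : 0 ≤ s ^ 2 := sq_nonneg s
  rw [tendsto_iff_dist_tendsto_zero]
  set K := kalmanError a s
  generalize s ^ 2 = r at *
  refine tendsto_zero_of_le_mul_add (ρ := r / (1 + r)) (η := 0) (fun _ => dist_nonneg)
    (by positivity) (by rw [div_lt_one (by positivity)]; linarith) (fun n => ?_)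
    tendsto_const_nhds
  have he := errVar_nonneg (a := a) h₀ hr n
  rw [errVar, predVar_succ, Real.dist_eq, Real.dist_eq, Pi.zero_apply, add_zero]
  set e := errVar a s₀ r n
  have hM : 0 < a ^ 2 * K + 1 := by positivity
  have hMr : 0 < a ^ 2 * K + 1 + r := by positivity
  have her : 0 < a ^ 2 * e + 1 + r := by positivity
  have h2 : (a ^ 2 * e + 1) * r / (a ^ 2 * e + 1 + r) - K =
      r / (a ^ 2 * e + 1 + r) * (a ^ 2 * r / (a ^ 2 * K + 1 + r)) * (e - K) := by
    field_simp
    linear_combination (-(a ^ 2 * e + 1 + r)) * h1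
  have h3 : a ^ 2 * r / (a ^ 2 * K + 1 + r) ≤ 1 := by
    rw [div_le_one hMr]
    have : (a ^ 2 * K + 1) * (a ^ 2 * r) = a ^ 2 * K * (a ^ 2 * K + 1 + r) := by
      linear_combination (-a ^ 2) * h1
    nlinarith
  have h4 : r / (a ^ 2 * e + 1 + r) ≤ r / (1 + r) := by
    refine div_le_div_of_nonneg_left hr (by positivity) ?_
    nlinarith [mul_nonneg (sq_nonneg a) he]
  rw [h2, abs_mul, abs_of_nonneg (by positivity)]
  refine mul_le_mul_of_nonneg_right ?_ (abs_nonneg _)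
  calc _ ≤ r / (1 + r) * 1 := mul_le_mul h4 h3 (by positivity) (by positivity)
    _ = _ := mul_one _

theorem tendsto_predVar_sub_errVar (a s : ℝ) (h₀ : 0 ≤ s₀) :
    Tendsto (fun n => predVar a s₀ (s ^ 2) (n + 1) - errVar a s₀ (s ^ 2) (n + 1)) atTop
      (𝓝 (steadyGain a s)) := by
  have h := tendsto_errVar a s h₀
  exact ((h.const_mul _).add_const 1).sub ((tendsto_add_atTop_iff_nat 1).2 h)

end Riccati

/-! ### The tradeoff between distortion and power, for moment sequences -/

section Tradeoff

/-- The bounds `2 A B ≤ t A² + B² / t`, `t > 0`, are jointly sharp. -/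
theorem sq_sub_le_of_forall_weight {A B c : ℝ} (hA : 0 ≤ A) (hB : 0 ≤ B)
    (h : ∀ t : ℝ, 0 < t → (1 - t) * A ^ 2 + (1 - t⁻¹) * B ^ 2 ≤ c) : (A - B) ^ 2 ≤ c := by
  have hlim : Tendsto (fun ε : ℝ => c + ε * (A + B)) (𝓝[>] 0) (𝓝 c) := by
    have : Tendsto (fun ε : ℝ => c + ε * (A + B)) (𝓝 0) (𝓝 (c + 0 * (A + B))) :=
      Continuous.tendsto (by fun_prop) 0
    simpa using this.mono_left nhdsWithin_le_nhds
  refine ge_of_tendsto hlim (eventually_nhdsWithin_of_forall fun ε hε => ?_)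
  have hε : 0 < ε := hε
  -- The optimal weight is `B / A`; the shift by `ε` keeps it positive and finite.
  have h1 := h ((B + ε) / (A + ε)) (by positivity)
  have h2 : (B + ε) / (A + ε) * A ^ 2 ≤ (B + ε) * A := by
    rw [div_mul_eq_mul_div, div_le_iff₀ (by positivity)]
    nlinarith [mul_nonneg (mul_nonneg (add_nonneg hB hε.le) hA) hε.le]
  have h3 : ((B + ε) / (A + ε))⁻¹ * B ^ 2 ≤ (A + ε) * B := by
    rw [inv_div, div_mul_eq_mul_div, div_le_iff₀ (by positivity)]
    nlinarith [mul_nonneg (mul_nonneg (add_nonneg hA hε.le) hB) hε.le]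
  linarith

/-- A stationary pair (second moment `X` of the estimate, power `U`) satisfying the moment
inequalities is dominated by a linear gain: `k = ± √(U / X)`, with the sign of `a`. -/
theorem exists_gain_of_stationary {a q X U : ℝ} (hq : 0 < q) (hX : 0 ≤ X) (hU : 0 ≤ U)
    (h : ∀ t : ℝ, 0 < t → (1 - t) * a ^ 2 * X + (1 - t⁻¹) * U + q ≤ X) :
    ∃ k : ℝ, |a - k| < 1 ∧ q / (1 - (a - k) ^ 2) ≤ X ∧ k ^ 2 * (q / (1 - (a - k) ^ 2)) ≤ U := by
  have hX' := Real.sq_sqrt hX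
  have hU' := Real.sq_sqrt hU
  have h1 : (|a| * √X - √U) ^ 2 ≤ X - q := by
    refine sq_sub_le_of_forall_weight (by positivity) (by positivity) fun t ht => ?_
    rw [mul_pow, sq_abs, hX', hU']
    linarith [h t ht]
  have hX0 : 0 < X := by nlinarith [sq_nonneg (|a| * √X - √U)]
  have hs : 0 < √X := Real.sqrt_pos.2 hX0
  obtain ⟨σ, hσ, hσa⟩ : ∃ σ : ℝ, σ ^ 2 = 1 ∧ a = σ * |a| := by
    rcases abs_choice a with h | h
    · exact ⟨1, by norm_num, by rw [h]; ring⟩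
    · exact ⟨-1, by norm_num, by rw [h]; ring⟩
  have h2 : X * (a - σ * (√U / √X)) ^ 2 = (|a| * √X - √U) ^ 2 := by
    have : (a - σ * (√U / √X)) ^ 2 = σ ^ 2 * (|a| - √U / √X) ^ 2 := by
      nth_rewrite 1 [hσa]
      ring
    rw [this, hσ]
    nth_rewrite 1 [← hX']
    field_simp
  have h3 : q ≤ X * (1 - (a - σ * (√U / √X)) ^ 2) := by linarith
  have h4 : 0 < 1 - (a - σ * (√U / √X)) ^ 2 := pos_of_mul_pos_right (hq.trans_le h3) hX
  have h5 : q / (1 - (a - σ * (√U / √X)) ^ 2) ≤ X := (div_le_iff₀ h4).2 h3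
  refine ⟨σ * (√U / √X), (sq_lt_one_iff_abs_lt_one _).1 (by linarith), h5, ?_⟩
  refine (mul_le_mul_of_nonneg_left h5 (sq_nonneg _)).trans_eq ?_
  rw [mul_pow, hσ, div_pow, hX', hU']
  field_simp

/-- On the efficient branch, smaller distortion costs strictly more power; here `a > 0`. -/
theorem power_lt_of_pos {a k k' : ℝ} (ha : 0 < a) (hk : |a - k| < 1) (hka : k ≤ a) (hk0 : 0 ≤ k)
    (hk1 : a ^ 2 - 1 ≤ a * k) (h : (a - k') ^ 2 < (a - k) ^ 2) :
    k ^ 2 * (1 - (a - k') ^ 2) < k' ^ 2 * (1 - (a - k) ^ 2) := by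
  have hlt : k < k' := by
    have := abs_lt_of_sq_lt_sq h (by linarith)
    linarith [(abs_lt.1 this).2]
  have h1 : 0 < (1 - a ^ 2) * (k' + k) + 2 * a * k * k' := by
    have h3 : a * k < a * k' := mul_lt_mul_of_pos_left hlt ha
    rcases hk0.eq_or_lt with rfl | hpos
    · have : a < 1 := by simpa using (abs_lt.1 hk).2
      have : 0 < 1 - a ^ 2 := by nlinarith
      have := mul_pos this hlt
      linarith
    · nlinarith [mul_nonneg (sub_nonneg.2 hk1) (hk0.trans hlt.le),
        mul_pos (sub_pos.2 (hk1.trans_lt h3)) hpos]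
  nlinarith [mul_pos (sub_pos.2 hlt) h1]

/-- On the efficient branch `|k| ≤ |a|`, `a k ≥ max 0 (a² - 1)`, a gain of no larger power has no
smaller distortion. -/
theorem distortion_le_of_power_le {a q k k' : ℝ} (hq : 0 < q) (hk : |a - k| < 1)
    (hka : |k| ≤ |a|) (hk0 : 0 ≤ a * k) (hk1 : a ^ 2 - 1 ≤ a * k) (hk' : |a - k'| < 1)
    (hP : k' ^ 2 * (q / (1 - (a - k') ^ 2)) ≤ k ^ 2 * (q / (1 - (a - k) ^ 2))) :
    q / (1 - (a - k) ^ 2) ≤ q / (1 - (a - k') ^ 2) := by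
  have h1 : 0 < 1 - (a - k) ^ 2 := by linarith [(sq_lt_one_iff_abs_lt_one _).2 hk]
  have h2 : 0 < 1 - (a - k') ^ 2 := by linarith [(sq_lt_one_iff_abs_lt_one _).2 hk']
  have hP' : k' ^ 2 * (1 - (a - k) ^ 2) ≤ k ^ 2 * (1 - (a - k') ^ 2) := by
    rw [← mul_div_assoc, ← mul_div_assoc, div_le_div_iff₀ h2 h1] at hP
    nlinarith
  refine div_le_div_of_nonneg_left hq.le h2 ?_
  by_contra! hlt
  replace hlt : (a - k') ^ 2 < (a - k) ^ 2 := by linarith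
  refine hP'.not_gt ?_
  rcases lt_trichotomy a 0 with ha | rfl | ha
  · have hk00 : k ≤ 0 := by nlinarith
    rw [abs_of_nonpos hk00, abs_of_neg ha] at hka
    have := power_lt_of_pos (a := -a) (k := -k) (k' := -k') (by linarith)
      (by rwa [← abs_neg, show -(-a - -k) = a - k by ring]) hka (by linarith)
      (by linarith) (by linarith)
    rw [show -a - -k' = -(a - k') by ring, show -a - -k = -(a - k) by ring] at this
    simpa only [neg_sq] using this
  · have : k = 0 := by simpa using hka
    subst this
    nlinarith [sq_nonneg k']
  · have hk00 : 0 ≤ k := nonneg_of_mul_nonneg_right hk0 ha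
    rw [abs_of_nonneg hk00, abs_of_pos ha] at hka
    exact power_lt_of_pos ha hk hka hk00 hk1 hlt

/-- If the averages of a nonnegative sequence are bounded, its terms cannot all grow linearly. -/
theorem frequently_div_le {X : ℕ → ℝ} {C : ℝ} (hX : ∀ n, 0 ≤ X n)
    (h : ∀ᶠ N : ℕ in atTop, (∑ i ∈ Finset.range N, X i) / N ≤ C) {ε : ℝ} (hε : 0 < ε) :
    ∃ᶠ N : ℕ in atTop, X N / N ≤ ε := by
  intro hc
  obtain ⟨N₁, hN₁⟩ := eventually_atTop.1 h
  obtain ⟨N₂, hN₂⟩ := eventually_atTop.1 hc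
  obtain ⟨N₃, hN₃⟩ := exists_nat_gt (2 * C / ε)
  set N := N₁ + N₂ + N₃ + 1
  have hN0 : (0 : ℝ) < N := by positivity
  have hN : 2 * C < N * ε := by
    rw [div_lt_iff₀ hε] at hN₃
    have : (N₃ : ℝ) ≤ N := by exact_mod_cast (show N₃ ≤ N by omega)
    nlinarith
  have h1 := hN₁ (2 * N) (by omega)
  rw [div_le_iff₀ (by push_cast; positivity)] at h1
  -- The `N` terms with index in `[N, 2 N)` all exceed `ε N`.
  have h2 : ∑ _i ∈ Finset.Ico N (2 * N), ε * N ≤ ∑ i ∈ Finset.range (2 * N), X i := by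
    refine (Finset.sum_le_sum fun i hi => ?_).trans
      (Finset.sum_le_sum_of_subset_of_nonneg (fun i hi => ?_) fun i _ _ => hX i)
    · have hi := Finset.mem_Ico.1 hi
      have h3 := not_le.1 (hN₂ i (by omega))
      have hi' : (N : ℝ) ≤ i := by exact_mod_cast hi.1
      rw [lt_div_iff₀ (hN0.trans_le hi')] at h3
      nlinarith
    · exact Finset.mem_range.2 (Finset.mem_Ico.1 hi).2
  rw [Finset.sum_const, Nat.card_Ico, show 2 * N - N = N by omega, nsmul_eq_mul] at h2
  push_cast at h1
  nlinarith [mul_lt_mul_of_pos_left hN hN0]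

/-- Averages that satisfy the moment inequalities have a stationary limit point. -/
theorem exists_stationary {a q D P : ℝ} {X U g : ℕ → ℝ} (hX : ∀ n, 0 ≤ X n) (hU : ∀ n, 0 ≤ U n)
    (hg : Tendsto g atTop (𝓝 q))
    (hstep : ∀ n, ∀ t : ℝ, 0 < t →
      (1 - t) * a ^ 2 * X n + (1 - t⁻¹) * U n + g n ≤ X (n + 1))
    (hD : ∀ ε > 0, ∀ᶠ N : ℕ in atTop, (∑ i ∈ Finset.range N, X i) / N ≤ D + ε)
    (hP : ∀ ε > 0, ∀ᶠ N : ℕ in atTop, (∑ i ∈ Finset.range N, U i) / N ≤ P + ε) :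
    ∃ X' U' : ℝ, 0 ≤ X' ∧ 0 ≤ U' ∧ X' ≤ D ∧ U' ≤ P ∧
      ∀ t : ℝ, 0 < t → (1 - t) * a ^ 2 * X' + (1 - t⁻¹) * U' + q ≤ X' := by
  set A : ℕ → ℝ := fun N => (∑ i ∈ Finset.range N, X i) / N with hAdef
  set B : ℕ → ℝ := fun N => (∑ i ∈ Finset.range N, U i) / N with hBdef
  have hA : ∀ N, 0 ≤ A N := fun N => div_nonneg (Finset.sum_nonneg fun i _ => hX i) (by simp)
  have hB : ∀ N, 0 ≤ B N := fun N => div_nonneg (Finset.sum_nonneg fun i _ => hU i) (by simp)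
  -- Along `φ` the boundary term `X N / N` vanishes; along `φ ∘ ψ` both averages converge.
  obtain ⟨φ, hφ, hφX⟩ := extraction_forall_of_frequently
    (P := fun n N => X N / N ≤ 1 / ((n : ℝ) + 1)) fun n =>
      frequently_div_le hX (hD 1 one_pos) (by positivity)
  have hφt := hφ.tendsto_atTop
  have hlast : Tendsto (fun n => X (φ n) / φ n) atTop (𝓝 0) :=
    squeeze_zero (fun n => div_nonneg (hX _) (by simp)) hφX tendsto_one_div_add_atTop_nhds_zero_nat
  obtain ⟨p, -, ψ, hψ, hp⟩ := (isCompact_Icc (a := ((0 : ℝ), (0 : ℝ)))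
      (b := (D + 1, P + 1))).tendsto_subseq' (x := fun n => (A (φ n), B (φ n))) <| by
    refine Eventually.frequently ?_
    filter_upwards [hφt.eventually (hD 1 one_pos), hφt.eventually (hP 1 one_pos)] with n h1 h2
    exact ⟨⟨hA _, hB _⟩, ⟨h1, h2⟩⟩
  have hψt := hψ.tendsto_atTop
  have hpA : Tendsto (fun n => A (φ (ψ n))) atTop (𝓝 p.1) := (continuous_fst.tendsto _).comp hp
  have hpB : Tendsto (fun n => B (φ (ψ n))) atTop (𝓝 p.2) := (continuous_snd.tendsto _).comp hp
  refine ⟨p.1, p.2, ge_of_tendsto' hpA fun _ => hA _, ge_of_tendsto' hpB fun _ => hB _,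
    le_of_forall_pos_le_add fun ε hε =>
      le_of_tendsto hpA ((hφt.comp hψt).eventually (hD ε hε)),
    le_of_forall_pos_le_add fun ε hε =>
      le_of_tendsto hpB ((hφt.comp hψt).eventually (hP ε hε)), fun t ht => ?_⟩
  have hG : Tendsto (fun n => ((φ (ψ n) : ℕ) : ℝ)⁻¹ * ∑ i ∈ Finset.range (φ (ψ n)), g i)
      atTop (𝓝 q) := hg.cesaro.comp (hφt.comp hψt)
  have hL := hlast.comp hψt
  have hlim := ((hpA.const_mul ((1 - t) * a ^ 2)).add (hpB.const_mul (1 - t⁻¹))).add hG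
  have hlim' := hpA.add hL
  rw [add_zero] at hlim'
  refine le_of_tendsto_of_tendsto' hlim hlim' fun n => ?_
  set N := φ (ψ n)
  -- The sum of the moment inequalities telescopes up to the two boundary terms.
  have h1 : ∑ i ∈ Finset.range N, ((1 - t) * a ^ 2 * X i + (1 - t⁻¹) * U i + g i) ≤
      ∑ i ∈ Finset.range N, X i + X N := by
    refine (Finset.sum_le_sum fun i _ => hstep i t ht).trans ?_
    rw [← Finset.sum_range_succ, Finset.sum_range_succ']
    linarith [hX 0]
  simp only [Finset.sum_add_distrib, ← Finset.mul_sum] at h1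
  have h2 := mul_le_mul_of_nonneg_right h1 (show 0 ≤ ((N : ℕ) : ℝ)⁻¹ by positivity)
  simp only [Function.comp, hAdef, hBdef, div_eq_mul_inv]
  linarith

end Tradeoff

/-! ### Prediction errors and innovations -/

section Innovations

/-- The primitive random variables as one family, indexed by `x₀`, then `w n`, then `v n`. -/
abbrev noise {Ω : Type*} (x₀ : Ω → ℝ) (w v : ℕ → Ω → ℝ) : Unit ⊕ ℕ ⊕ ℕ → Ω → ℝ :=
  Sum.elim (fun _ => x₀) (Sum.elim w v)

/-- The linear combination of the primitive random variables with coefficients `c`. -/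
noncomputable def comb {Ω : Type*} (x₀ : Ω → ℝ) (w v : ℕ → Ω → ℝ) :
    (Unit ⊕ ℕ ⊕ ℕ →₀ ℝ) →ₗ[ℝ] Ω → ℝ :=
  Finsupp.linearCombination ℝ (noise x₀ w v)

theorem comb_apply {Ω : Type*} {x₀ : Ω → ℝ} {w v : ℕ → Ω → ℝ} (c : Unit ⊕ ℕ ⊕ ℕ →₀ ℝ) (ω : Ω) :
    comb x₀ w v c ω = ∑ i ∈ c.support, c i * noise x₀ w v i ω := by
  simp [comb, Finsupp.linearCombination_apply, Finsupp.sum]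

theorem comb_single {Ω : Type*} {x₀ : Ω → ℝ} {w v : ℕ → Ω → ℝ} (i : Unit ⊕ ℕ ⊕ ℕ) :
    comb x₀ w v (Finsupp.single i 1) = noise x₀ w v i := by
  simp [comb]

/-- The error of the one-step prediction of the state, as a combination of the primitive random
variables. It does not depend on the control. -/
noncomputable def predErr (a s₀ r : ℝ) : ℕ → Unit ⊕ ℕ ⊕ ℕ →₀ ℝ
  | 0 => .single (.inl ()) 1
  | n + 1 => a • (predErr a s₀ r n -
      gain a s₀ r n • (predErr a s₀ r n + .single (.inr (.inr n)) 1)) + .single (.inr (.inl n)) 1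

/-- The innovation: the error of the one-step prediction of the observation. -/
noncomputable def innov (a s₀ r : ℝ) (n : ℕ) : Unit ⊕ ℕ ⊕ ℕ →₀ ℝ :=
  predErr a s₀ r n + .single (.inr (.inr n)) 1

/-- The error of the estimate of the state. -/
noncomputable def err (a s₀ r : ℝ) (n : ℕ) : Unit ⊕ ℕ ⊕ ℕ →₀ ℝ :=
  predErr a s₀ r n - gain a s₀ r n • innov a s₀ r n

theorem predErr_succ (a s₀ r : ℝ) (n : ℕ) :
    predErr a s₀ r (n + 1) = a • err a s₀ r n + .single (.inr (.inl n)) 1 := rfl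

variable {Ω : Type*} [mΩ : MeasurableSpace Ω] {μ : Measure Ω} {σ₀ σᵥ : ℝ≥0}
  {x₀ : Ω → ℝ} {w v : ℕ → Ω → ℝ}

theorem IsNoise.measurable_noise (h : IsNoise μ σ₀ σᵥ x₀ w v) :
    ∀ i, Measurable (noise x₀ w v i)
  | .inl _ => h.measurable_init
  | .inr (.inl n) => h.measurable_process n
  | .inr (.inr n) => h.measurable_obs n

/-- The variances of the primitive random variables. -/
def noiseVar (σ₀ σᵥ : ℝ≥0) : Unit ⊕ ℕ ⊕ ℕ → ℝ≥0 :=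
  Sum.elim (fun _ => σ₀ ^ 2) (Sum.elim (fun _ => 1) fun _ => σᵥ ^ 2)

theorem IsNoise.map_noise (h : IsNoise μ σ₀ σᵥ x₀ w v) :
    ∀ i, μ.map (noise x₀ w v i) = gaussianReal 0 (noiseVar σ₀ σᵥ i)
  | .inl _ => h.law_init
  | .inr (.inl n) => h.law_process n
  | .inr (.inr n) => h.law_obs n

theorem IsNoise.hasGaussianLaw_noise (h : IsNoise μ σ₀ σᵥ x₀ w v) (i : Unit ⊕ ℕ ⊕ ℕ) :
    HasGaussianLaw (noise x₀ w v i) μ :=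
  ⟨by rw [h.map_noise]; infer_instance⟩

theorem IsNoise.integral_noise (h : IsNoise μ σ₀ σᵥ x₀ w v) (i : Unit ⊕ ℕ ⊕ ℕ) :
    ∫ ω, noise x₀ w v i ω ∂μ = 0 := by
  have := integral_map (μ := μ) (h.measurable_noise i).aemeasurable (f := id)
    aestronglyMeasurable_id
  rw [h.map_noise] at this
  simpa using this.symm

theorem IsNoise.isGaussianProcess_noise (h : IsNoise μ σ₀ σᵥ x₀ w v) :
    IsGaussianProcess (noise x₀ w v) μ where
  hasGaussianLaw I :=
    iIndepFun.hasGaussianLaw (X := fun i : I => noise x₀ w v i)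
      (fun i => h.hasGaussianLaw_noise i) (h.indep.precomp Subtype.val_injective)

theorem IsNoise.isGaussianProcess_comb (h : IsNoise μ σ₀ σᵥ x₀ w v) :
    IsGaussianProcess (comb x₀ w v : (Unit ⊕ ℕ ⊕ ℕ →₀ ℝ) → Ω → ℝ) μ where
  hasGaussianLaw I := by
    set J := I.biUnion Finsupp.support
    have h1 : (fun ω => I.restrict fun c => comb x₀ w v c ω) =
        ContinuousLinearMap.pi (fun c : I => ∑ j : J, c.1 j •
          ContinuousLinearMap.proj (R := ℝ) (φ := fun _ : J => ℝ) j) ∘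
          fun ω => J.restrict fun j => noise x₀ w v j ω := by
      ext ω c
      have h2 : ∑ j ∈ c.1.support, c.1 j * noise x₀ w v j ω = ∑ j ∈ J, c.1 j * noise x₀ w v j ω :=
        Finset.sum_subset (Finset.subset_biUnion_of_mem _ c.2) fun j _ hj => by
          simp [Finsupp.notMem_support_iff.1 hj]
      rw [← Finset.sum_coe_sort J] at h2
      simp [comb_apply, h2]
    rw [h1]
    exact (h.isGaussianProcess_noise.hasGaussianLaw J).map _

theorem IsNoise.measurable_comb (h : IsNoise μ σ₀ σᵥ x₀ w v) (c : Unit ⊕ ℕ ⊕ ℕ →₀ ℝ) :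
    Measurable (comb x₀ w v c) := by
  rw [show comb x₀ w v c = fun ω => ∑ i ∈ c.support, c i * noise x₀ w v i ω from
    funext (comb_apply c)]
  exact Finset.measurable_sum _ fun i _ => (h.measurable_noise i).const_mul _

theorem IsNoise.memLp_comb (h : IsNoise μ σ₀ σᵥ x₀ w v) (c : Unit ⊕ ℕ ⊕ ℕ →₀ ℝ) :
    MemLp (comb x₀ w v c) 2 μ :=
  (h.isGaussianProcess_comb.hasGaussianLaw_eval c).memLp_two

theorem IsNoise.integral_comb (h : IsNoise μ σ₀ σᵥ x₀ w v) (c : Unit ⊕ ℕ ⊕ ℕ →₀ ℝ) :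
    ∫ ω, comb x₀ w v c ω ∂μ = 0 := by
  simp_rw [comb_apply]
  rw [integral_finsetSum _ fun i _ => (h.hasGaussianLaw_noise i).integrable.const_mul _]
  exact Finset.sum_eq_zero fun i _ => by rw [integral_const_mul, h.integral_noise, mul_zero]

/-- The information carried by the innovations at times `0, …, n`. -/
@[reducible]
noncomputable def innovInfo {Ω : Type*} (a s₀ r : ℝ) (x₀ : Ω → ℝ) (w v : ℕ → Ω → ℝ) (n : ℕ) :
    MeasurableSpace Ω :=
  MeasurableSpace.comap (fun ω (i : Set.Iic n) => comb x₀ w v (innov a s₀ r i) ω) inferInstance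

theorem measurable_innov {Ω : Type*} {a s₀ r : ℝ} {x₀ : Ω → ℝ} {w v : ℕ → Ω → ℝ} {i n : ℕ}
    (hi : i ≤ n) :
    Measurable[innovInfo a s₀ r x₀ w v n] (comb x₀ w v (innov a s₀ r i)) := by
  let := innovInfo a s₀ r x₀ w v n
  exact (measurable_pi_apply (⟨i, hi⟩ : Set.Iic n)).comp
    (comap_measurable fun ω (i : Set.Iic n) => comb x₀ w v (innov a s₀ r i) ω)

theorem innovInfo_mono {Ω : Type*} {a s₀ r : ℝ} {x₀ : Ω → ℝ} {w v : ℕ → Ω → ℝ} {m n : ℕ}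
    (hmn : m ≤ n) : innovInfo a s₀ r x₀ w v m ≤ innovInfo a s₀ r x₀ w v n := by
  rw [innovInfo, ← measurable_iff_comap_le]
  exact @measurable_pi_lambda _ _ _ (_) _ _ fun i => measurable_innov (le_trans i.2 hmn)

theorem IsNoise.innovInfo_le (h : IsNoise μ σ₀ σᵥ x₀ w v) (a s₀ r : ℝ) (n : ℕ) :
    innovInfo a s₀ r x₀ w v n ≤ mΩ := by
  rw [innovInfo, ← measurable_iff_comap_le]
  exact measurable_pi_lambda _ fun i => h.measurable_comb _

variable [IsProbabilityMeasure μ]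

/-- The covariance of two combinations of the primitive random variables, as a bilinear form in
the coefficients. -/
noncomputable def IsNoise.cov (h : IsNoise μ σ₀ σᵥ x₀ w v) :
    (Unit ⊕ ℕ ⊕ ℕ →₀ ℝ) →ₗ[ℝ] (Unit ⊕ ℕ ⊕ ℕ →₀ ℝ) →ₗ[ℝ] ℝ :=
  LinearMap.mk₂ ℝ (fun c d => cov[comb x₀ w v c, comb x₀ w v d; μ])
    (fun c c' d => by
      rw [map_add, covariance_add_left (h.memLp_comb c) (h.memLp_comb c') (h.memLp_comb d)])
    (fun t c d => by rw [map_smul, covariance_smul_left, smul_eq_mul])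
    (fun c d d' => by
      rw [map_add, covariance_add_right (h.memLp_comb c) (h.memLp_comb d) (h.memLp_comb d')])
    (fun t c d => by rw [map_smul, covariance_smul_right, smul_eq_mul])

theorem IsNoise.cov_apply (h : IsNoise μ σ₀ σᵥ x₀ w v) (c d : Unit ⊕ ℕ ⊕ ℕ →₀ ℝ) :
    h.cov c d = cov[comb x₀ w v c, comb x₀ w v d; μ] := rfl

theorem IsNoise.cov_comm (h : IsNoise μ σ₀ σᵥ x₀ w v) (c d : Unit ⊕ ℕ ⊕ ℕ →₀ ℝ) :
    h.cov c d = h.cov d c := covariance_comm _ _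

theorem IsNoise.cov_single_self (h : IsNoise μ σ₀ σᵥ x₀ w v) (i : Unit ⊕ ℕ ⊕ ℕ) :
    h.cov (.single i 1) (.single i 1) = noiseVar σ₀ σᵥ i := by
  rw [h.cov_apply, comb_single, covariance_self (h.measurable_noise i).aemeasurable]
  have := variance_map (μ := μ) (X := id) (Y := noise x₀ w v i) aemeasurable_id
    (h.measurable_noise i).aemeasurable
  rw [h.map_noise, variance_id_gaussianReal] at this
  exact this.symm

theorem IsNoise.cov_single_of_ne (h : IsNoise μ σ₀ σᵥ x₀ w v) {i j : Unit ⊕ ℕ ⊕ ℕ} (hij : i ≠ j) :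
    h.cov (.single i 1) (.single j 1) = 0 := by
  rw [h.cov_apply, comb_single, comb_single]
  exact (h.indep.indepFun hij).covariance_eq_zero (h.hasGaussianLaw_noise i).memLp_two
    (h.hasGaussianLaw_noise j).memLp_two

/-! ### Covariances of the errors and the innovations -/

section Covariances

variable (h : IsNoise μ σ₀ σᵥ x₀ w v) (a : ℝ)
include h

theorem IsNoise.cov_process_predErr {m n : ℕ} (hmn : n ≤ m) :
    h.cov (.single (.inr (.inl m)) 1) (predErr a (σ₀ ^ 2) (σᵥ ^ 2) n) = 0 := by
  induction n with
  | zero => exact h.cov_single_of_ne (by simp)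
  | succ n ih =>
    simp [predErr, ih (by omega), h.cov_single_of_ne, show m ≠ n by omega, -Finsupp.smul_single]

theorem IsNoise.cov_obs_predErr {m n : ℕ} (hmn : n ≤ m) :
    h.cov (.single (.inr (.inr m)) 1) (predErr a (σ₀ ^ 2) (σᵥ ^ 2) n) = 0 := by
  induction n with
  | zero => exact h.cov_single_of_ne (by simp)
  | succ n ih =>
    simp [predErr, ih (by omega), h.cov_single_of_ne, show m ≠ n by omega, -Finsupp.smul_single]

theorem IsNoise.cov_process_innov {m n : ℕ} (hmn : n ≤ m) :
    h.cov (.single (.inr (.inl m)) 1) (innov a (σ₀ ^ 2) (σᵥ ^ 2) n) = 0 := by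
  simp [innov, h.cov_process_predErr a hmn, h.cov_single_of_ne]

theorem IsNoise.cov_obs_innov {m n : ℕ} (hmn : n < m) :
    h.cov (.single (.inr (.inr m)) 1) (innov a (σ₀ ^ 2) (σᵥ ^ 2) n) = 0 := by
  simp [innov, h.cov_obs_predErr a hmn.le, h.cov_single_of_ne, hmn.ne']

theorem IsNoise.cov_process_err {m n : ℕ} (hmn : n ≤ m) :
    h.cov (.single (.inr (.inl m)) 1) (err a (σ₀ ^ 2) (σᵥ ^ 2) n) = 0 := by
  simp [err, h.cov_process_predErr a hmn, h.cov_process_innov a hmn]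

/-- The innovation is the prediction error plus the current observation noise, with which the
prediction error is uncorrelated. -/
theorem IsNoise.cov_innov_of_cov_predErr {n : ℕ} {M : ℝ}
    (hM : h.cov (predErr a (σ₀ ^ 2) (σᵥ ^ 2) n) (predErr a (σ₀ ^ 2) (σᵥ ^ 2) n) = M) :
    h.cov (innov a (σ₀ ^ 2) (σᵥ ^ 2) n) (innov a (σ₀ ^ 2) (σᵥ ^ 2) n) = M + σᵥ ^ 2 ∧
    h.cov (predErr a (σ₀ ^ 2) (σᵥ ^ 2) n) (innov a (σ₀ ^ 2) (σᵥ ^ 2) n) = M := by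
  have h1 := h.cov_obs_predErr a (le_refl n)
  have h2 := h1
  rw [h.cov_comm] at h2
  simp [innov, hM, h1, h2, h.cov_single_self, noiseVar]

theorem IsNoise.cov_predErr_self (n : ℕ) :
    h.cov (predErr a (σ₀ ^ 2) (σᵥ ^ 2) n) (predErr a (σ₀ ^ 2) (σᵥ ^ 2) n) =
      predVar a (σ₀ ^ 2) (σᵥ ^ 2) n := by
  induction n with
  | zero => simp [predErr, h.cov_single_self, noiseVar, predVar]
  | succ n ih =>
    obtain ⟨h1, h2⟩ := h.cov_innov_of_cov_predErr a ih
    have h3 := h2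
    rw [h.cov_comm] at h3
    have h4 := h.cov_process_err a (le_refl n)
    have h5 := h4
    rw [h.cov_comm] at h5
    have h6 := gain_mul_add (a := a) (sq_nonneg (σ₀ : ℝ)) (sq_nonneg (σᵥ : ℝ)) n
    have h7 := errVar_eq (a := a) (sq_nonneg (σ₀ : ℝ)) (sq_nonneg (σᵥ : ℝ)) n
    have h8 : h.cov (err a (σ₀ ^ 2) (σᵥ ^ 2) n) (err a (σ₀ ^ 2) (σᵥ ^ 2) n) =
        errVar a (σ₀ ^ 2) (σᵥ ^ 2) n := by
      simp only [err, map_sub, map_smul, LinearMap.sub_apply, LinearMap.smul_apply, smul_eq_mul,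
        ih, h1, h2, h3]
      linear_combination gain a (σ₀ ^ 2) (σᵥ ^ 2) n * h6 - h7
    rw [predErr_succ, predVar_succ]
    simp only [map_add, map_smul, LinearMap.add_apply, LinearMap.smul_apply, smul_eq_mul,
      h4, h5, h8, h.cov_single_self]
    simp [noiseVar]
    ring

theorem IsNoise.cov_innov_self (n : ℕ) :
    h.cov (innov a (σ₀ ^ 2) (σᵥ ^ 2) n) (innov a (σ₀ ^ 2) (σᵥ ^ 2) n) =
      predVar a (σ₀ ^ 2) (σᵥ ^ 2) n + σᵥ ^ 2 :=
  (h.cov_innov_of_cov_predErr a (h.cov_predErr_self a n)).1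

theorem IsNoise.cov_err_innov_self (n : ℕ) :
    h.cov (err a (σ₀ ^ 2) (σᵥ ^ 2) n) (innov a (σ₀ ^ 2) (σᵥ ^ 2) n) = 0 := by
  obtain ⟨h1, h2⟩ := h.cov_innov_of_cov_predErr a (h.cov_predErr_self a n)
  simp [err, h1, h2, gain_mul_add (a := a) (sq_nonneg (σ₀ : ℝ)) (sq_nonneg (σᵥ : ℝ)) n]

theorem IsNoise.cov_err_self (n : ℕ) :
    h.cov (err a (σ₀ ^ 2) (σᵥ ^ 2) n) (err a (σ₀ ^ 2) (σᵥ ^ 2) n) =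
      errVar a (σ₀ ^ 2) (σᵥ ^ 2) n := by
  have h1 := h.cov_err_innov_self a n
  have h2 := (h.cov_innov_of_cov_predErr a (h.cov_predErr_self a n)).2
  rw [h.cov_comm] at h2
  conv_lhs => enter [2]; rw [err]
  rw [map_sub, map_smul, h1, err, map_sub, LinearMap.sub_apply, map_smul, LinearMap.smul_apply,
    h2, h.cov_predErr_self a n, errVar_eq (sq_nonneg _) (sq_nonneg _)]
  simp
  ring

/-- The estimation error and the next innovation are uncorrelated with all earlier innovations. -/
theorem IsNoise.cov_err_innov {n i : ℕ} (hi : i ≤ n) :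
    h.cov (err a (σ₀ ^ 2) (σᵥ ^ 2) n) (innov a (σ₀ ^ 2) (σᵥ ^ 2) i) = 0 ∧
    h.cov (innov a (σ₀ ^ 2) (σᵥ ^ 2) (n + 1)) (innov a (σ₀ ^ 2) (σᵥ ^ 2) i) = 0 := by
  have key : ∀ n, i ≤ n → h.cov (err a (σ₀ ^ 2) (σᵥ ^ 2) n) (innov a (σ₀ ^ 2) (σᵥ ^ 2) i) = 0 →
      h.cov (innov a (σ₀ ^ 2) (σᵥ ^ 2) (n + 1)) (innov a (σ₀ ^ 2) (σᵥ ^ 2) i) = 0 ∧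
      h.cov (predErr a (σ₀ ^ 2) (σᵥ ^ 2) (n + 1)) (innov a (σ₀ ^ 2) (σᵥ ^ 2) i) = 0 := by
    intro n hin he
    have h1 : h.cov (predErr a (σ₀ ^ 2) (σᵥ ^ 2) (n + 1)) (innov a (σ₀ ^ 2) (σᵥ ^ 2) i) = 0 := by
      simp [predErr_succ, he, h.cov_process_innov a hin]
    refine ⟨?_, h1⟩
    rw [innov, map_add, LinearMap.add_apply, h1, h.cov_obs_innov a (by omega), add_zero]
  have he : ∀ n, i ≤ n → h.cov (err a (σ₀ ^ 2) (σᵥ ^ 2) n) (innov a (σ₀ ^ 2) (σᵥ ^ 2) i) = 0 := by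
    intro n hin
    induction n, hin using Nat.le_induction with
    | base => exact h.cov_err_innov_self a i
    | succ n hin ih =>
      obtain ⟨h1, h2⟩ := key n hin ih
      rw [err, map_sub, LinearMap.sub_apply, map_smul, LinearMap.smul_apply, h1, h2]
      simp
  exact ⟨he n hi, (key n hi (he n hi)).1⟩

end Covariances

/-- Jointly Gaussian and uncorrelated, hence independent. -/
theorem IsNoise.indep_innovInfo (h : IsNoise μ σ₀ σᵥ x₀ w v) {a : ℝ} {n : ℕ}
    {c : Unit ⊕ ℕ ⊕ ℕ →₀ ℝ} (hc : ∀ i ≤ n, h.cov c (innov a (σ₀ ^ 2) (σᵥ ^ 2) i) = 0) :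
    Indep (MeasurableSpace.comap (comb x₀ w v c) inferInstance)
      (innovInfo a (σ₀ ^ 2) (σᵥ ^ 2) x₀ w v n) μ := by
  have h1 : IsGaussianProcess (Sum.elim (fun _ : Unit => comb x₀ w v c)
      fun i : Set.Iic n => comb x₀ w v (innov a (σ₀ ^ 2) (σᵥ ^ 2) i)) μ := by
    rw [show (Sum.elim (fun _ : Unit => comb x₀ w v c)
        fun i : Set.Iic n => comb x₀ w v (innov a (σ₀ ^ 2) (σᵥ ^ 2) i)) = comb x₀ w v ∘
        Sum.elim (fun _ : Unit => c) fun i : Set.Iic n => innov a (σ₀ ^ 2) (σᵥ ^ 2) i by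
          ext (i | i) <;> rfl]
    exact h.isGaussianProcess_comb.comp_right _
  have h2 := h1.indepFun_of_covariance_eq_zero (fun _ => (h.measurable_comb _).aemeasurable)
    (fun _ => (h.measurable_comb _).aemeasurable) fun _ i => hc i i.2
  exact (h2.comp (measurable_pi_apply ()) measurable_id :)

end Innovations

/-! ### Second moments and average costs -/

section SecondMoment

variable {Ω : Type*} [mΩ : MeasurableSpace Ω] {μ : Measure Ω}

theorem secondMoment_congr {X Y : Ω → ℝ} (h : X =ᵐ[μ] Y) : secondMoment μ X = secondMoment μ Y :=
  lintegral_congr_ae <| h.mono fun ω hω => by simp only [hω]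

theorem secondMoment_const_mul (c : ℝ) (X : Ω → ℝ) :
    secondMoment μ (fun ω => c * X ω) = ENNReal.ofReal (c ^ 2) * secondMoment μ X := by
  simp_rw [secondMoment, mul_pow, ENNReal.ofReal_mul (sq_nonneg c)]
  exact lintegral_const_mul' _ _ ENNReal.ofReal_ne_top

theorem secondMoment_eq_ofReal {X : Ω → ℝ} (hX : MemLp X 2 μ) :
    secondMoment μ X = ENNReal.ofReal (∫ ω, X ω ^ 2 ∂μ) :=
  (ofReal_integral_eq_lintegral_ofReal hX.integrable_sq (ae_of_all _ fun _ => sq_nonneg _)).symm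

theorem memLp_two_iff_secondMoment {X : Ω → ℝ} (hX : AEStronglyMeasurable X μ) :
    MemLp X 2 μ ↔ secondMoment μ X ≠ ∞ := by
  refine ⟨fun h => by rw [secondMoment_eq_ofReal h]; exact ENNReal.ofReal_ne_top, fun h => ?_⟩
  rw [memLp_two_iff_integrable_sq hX]
  exact ⟨hX.pow 2, (hasFiniteIntegral_iff_ofReal (ae_of_all _ fun _ => sq_nonneg _)).2
    (lt_top_iff_ne_top.2 h)⟩

/-- Pythagoras; both sides are infinite if `Y` is not square integrable. -/
theorem secondMoment_add_of_indepFun [IsProbabilityMeasure μ] {X Y : Ω → ℝ} (hX : MemLp X 2 μ)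
    (h0 : ∫ ω, X ω ∂μ = 0) (hY : AEStronglyMeasurable Y μ) (h : IndepFun X Y μ) :
    secondMoment μ (fun ω => X ω + Y ω) = secondMoment μ X + secondMoment μ Y := by
  by_cases hY2 : MemLp Y 2 μ
  · change secondMoment μ (X + Y) = _
    rw [secondMoment_eq_ofReal (hX.add hY2), secondMoment_eq_ofReal hX, secondMoment_eq_ofReal hY2,
      ← ENNReal.ofReal_add (integral_nonneg fun _ => sq_nonneg _)
        (integral_nonneg fun _ => sq_nonneg _)]
    congr 1
    have hXY : Integrable (fun ω => X ω * Y ω) μ := hX.integrable_mul hY2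
    have hXY0 : ∫ ω, X ω * Y ω ∂μ = 0 := by
      rw [h.integral_fun_mul_eq_mul_integral hX.1 hY, h0, zero_mul]
    calc ∫ ω, (X ω + Y ω) ^ 2 ∂μ = ∫ ω, (X ω ^ 2 + Y ω ^ 2) + 2 * (X ω * Y ω) ∂μ := by
          congr with ω; ring
      _ = _ := by
          rw [integral_add (by exact hX.integrable_sq.add hY2.integrable_sq) (hXY.const_mul 2),
            integral_add hX.integrable_sq hY2.integrable_sq, integral_const_mul, hXY0]
          ring
  · have h1 : secondMoment μ Y = ∞ := not_not.1 fun h => hY2 ((memLp_two_iff_secondMoment hY).2 h)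
    rw [h1, add_top]
    by_contra h2
    refine hY2 ?_
    convert ((memLp_two_iff_secondMoment (hX.1.add hY)).2 h2).sub hX using 1
    ext ω
    simp

theorem sum_Icc_one_eq_sum_range {M : Type*} [AddCommMonoid M] (g : ℕ → M) (N : ℕ) :
    ∑ n ∈ Finset.Icc 1 N, g n = ∑ i ∈ Finset.range N, g (i + 1) := by
  rw [Finset.range_eq_Ico, Finset.sum_Ico_add' g 0 N 1]
  rfl

theorem averageCost_of_tendsto {z : ℕ → Ω → ℝ} {b : ℕ → ℝ} {β : ℝ} (hb : ∀ n, 0 ≤ b n)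
    (hz : ∀ n, secondMoment μ (z n) = ENNReal.ofReal (b n)) (hβ : Tendsto b atTop (𝓝 β)) :
    averageCost μ z = ENNReal.ofReal β := by
  refine Tendsto.limsup_eq ?_
  have h1 := ENNReal.tendsto_ofReal ((tendsto_add_atTop_iff_nat 1).2 hβ).cesaro
  refine h1.congr' ?_
  filter_upwards [eventually_gt_atTop 0] with N hN
  simp_rw [sum_Icc_one_eq_sum_range, hz]
  rw [← ENNReal.ofReal_sum_of_nonneg fun i _ => hb _, ← ENNReal.ofReal_natCast,
    ← ENNReal.ofReal_div_of_pos (by exact_mod_cast hN), inv_mul_eq_div]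

theorem secondMoment_ne_top_of_averageCost_le {z : ℕ → Ω → ℝ} {C : ℝ≥0}
    (hz : averageCost μ z ≤ C) (n : ℕ) : secondMoment μ (z (n + 1)) ≠ ∞ := by
  have h1 : averageCost μ z < ∞ := hz.trans_lt ENNReal.coe_lt_top
  obtain ⟨N, hN, hnN⟩ := ((eventually_lt_of_limsup_lt h1).and (eventually_ge_atTop (n + 1))).exists
  intro htop
  have h2 : ∑ i ∈ Finset.Icc 1 N, secondMoment μ (z i) = ∞ :=
    ENNReal.sum_eq_top.2 ⟨n + 1, Finset.mem_Icc.2 ⟨by omega, hnN⟩, htop⟩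
  rw [h2, ENNReal.top_div_of_ne_top (ENNReal.natCast_ne_top N)] at hN
  exact hN.ne rfl

theorem eventually_average_le {z : ℕ → Ω → ℝ} {C : ℝ≥0} (hz : averageCost μ z ≤ C) {ε : ℝ}
    (hε : 0 < ε) :
    ∀ᶠ N : ℕ in atTop,
      (∑ i ∈ Finset.range N, (secondMoment μ (z (i + 1))).toReal) / N ≤ C + ε := by
  have h1 : averageCost μ z < ENNReal.ofReal (C + ε) := by
    refine hz.trans_lt ?_
    rw [← ENNReal.ofReal_coe_nnreal]
    exact (ENNReal.ofReal_lt_ofReal_iff (by positivity)).2 (by linarith)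
  filter_upwards [eventually_lt_of_limsup_lt h1] with N hN
  have h2 := ENNReal.toReal_mono ENNReal.ofReal_ne_top hN.le
  rwa [ENNReal.toReal_ofReal (by positivity), sum_Icc_one_eq_sum_range, ENNReal.toReal_div,
    ENNReal.toReal_natCast, ENNReal.toReal_sum fun i _ =>
      secondMoment_ne_top_of_averageCost_le hz i] at h2

/-- The weighted form `2 |a X U| ≤ t a² X² + U² / t` of the Cauchy-Schwarz inequality. It is
linear in the second moments, so it survives averaging over time. -/
theorem le_toReal_secondMoment_add {X U : Ω → ℝ} (hX : MemLp X 2 μ) (hU : MemLp U 2 μ) (a : ℝ)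
    {t : ℝ} (ht : 0 < t) :
    (1 - t) * a ^ 2 * (secondMoment μ X).toReal + (1 - t⁻¹) * (secondMoment μ U).toReal ≤
      (secondMoment μ fun ω => a * X ω + U ω).toReal := by
  have hXU : MemLp (fun ω => a * X ω + U ω) 2 μ := (hX.const_mul a).add hU
  rw [secondMoment_eq_ofReal hX, secondMoment_eq_ofReal hU, secondMoment_eq_ofReal hXU,
    ENNReal.toReal_ofReal (integral_nonneg fun _ => sq_nonneg _),
    ENNReal.toReal_ofReal (integral_nonneg fun _ => sq_nonneg _),
    ENNReal.toReal_ofReal (integral_nonneg fun _ => sq_nonneg _), ← integral_const_mul,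
    ← integral_const_mul, ← integral_add (hX.integrable_sq.const_mul _)
      (hU.integrable_sq.const_mul _)]
  refine integral_mono ((hX.integrable_sq.const_mul _).add (hU.integrable_sq.const_mul _))
    hXU.integrable_sq fun ω => ?_
  have h1 : (a * X ω + U ω) ^ 2 -
      ((1 - t) * a ^ 2 * X ω ^ 2 + (1 - t⁻¹) * U ω ^ 2) = t * (a * X ω + t⁻¹ * U ω) ^ 2 := by
    field_simp
    ring
  have h2 : 0 ≤ t * (a * X ω + t⁻¹ * U ω) ^ 2 := by positivity
  simp only
  linarith

end SecondMoment

/-! ### The Kalman filter along an arbitrary strategy -/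

section Control

section Pathwise

variable {Ω : Type*} (a s₀ r : ℝ) (f : CausalStrategy) (x₀ : Ω → ℝ) (w v : ℕ → Ω → ℝ)

/-- The output of the Kalman filter: the state minus the estimation error. It is a version of
`estimate` wherever the latter is not a junk value, but it makes sense for every strategy. -/
noncomputable def kalmanFilter (n : ℕ) (ω : Ω) : ℝ :=
  state a f x₀ w v n ω - comb x₀ w v (err a s₀ r n) ω

theorem state_eq_kalmanFilter_add (n : ℕ) (ω : Ω) :
    state a f x₀ w v n ω =
      comb x₀ w v (err a s₀ r n) ω + kalmanFilter a s₀ r f x₀ w v n ω := by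
  simp [kalmanFilter]

theorem obs_zero (ω : Ω) : obs a f x₀ w v 0 ω = comb x₀ w v (innov a s₀ r 0) ω := by
  simp [obs, state_zero, innov, predErr, map_add, comb_single]

theorem kalmanFilter_zero (ω : Ω) :
    kalmanFilter a s₀ r f x₀ w v 0 ω = gain a s₀ r 0 * obs a f x₀ w v 0 ω := by
  rw [obs_zero a s₀ r]
  simp [kalmanFilter, state_zero, err, predErr, comb_single]

theorem obs_succ (n : ℕ) (ω : Ω) :
    obs a f x₀ w v (n + 1) ω =
      a * kalmanFilter a s₀ r f x₀ w v n ω + control a f x₀ w v n ω +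
        comb x₀ w v (innov a s₀ r (n + 1)) ω := by
  simp only [obs, state_succ, kalmanFilter, innov, predErr_succ, map_add, map_smul, comb_single,
    Pi.add_apply, Pi.smul_apply, smul_eq_mul, Sum.elim_inr, Sum.elim_inl]
  ring

theorem kalmanFilter_succ (n : ℕ) (ω : Ω) :
    kalmanFilter a s₀ r f x₀ w v (n + 1) ω =
      gain a s₀ r (n + 1) * comb x₀ w v (innov a s₀ r (n + 1)) ω +
        (a * kalmanFilter a s₀ r f x₀ w v n ω + control a f x₀ w v n ω) := by
  simp only [state_succ, kalmanFilter, err, predErr_succ, map_add, map_sub, map_smul, comb_single,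
    Pi.add_apply, Pi.sub_apply, Pi.smul_apply, smul_eq_mul, Sum.elim_inr, Sum.elim_inl]
  ring

/-- The recursion by which the filter is computed from the observations. -/
theorem kalmanFilter_succ_of_obs (n : ℕ) (ω : Ω) :
    kalmanFilter a s₀ r f x₀ w v (n + 1) ω =
      (a * kalmanFilter a s₀ r f x₀ w v n ω + control a f x₀ w v n ω) +
        gain a s₀ r (n + 1) * (obs a f x₀ w v (n + 1) ω -
          (a * kalmanFilter a s₀ r f x₀ w v n ω + control a f x₀ w v n ω)) := by
  rw [kalmanFilter_succ, obs_succ a s₀ r]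
  ring

variable {a s₀ r f x₀ w v}

theorem measurable_control_of_obs {m : MeasurableSpace Ω} {n : ℕ}
    (h : ∀ i ≤ n, Measurable[m] (obs a f x₀ w v i)) : Measurable[m] (control a f x₀ w v n) :=
  (f.measurable_law n).comp (measurable_pi_lambda _ fun i => h i (Nat.lt_succ_iff.1 i.2))

theorem measurable_kalmanFilter_of_obs {m : MeasurableSpace Ω} {n : ℕ}
    (h : ∀ i ≤ n, Measurable[m] (obs a f x₀ w v i)) :
    Measurable[m] (kalmanFilter a s₀ r f x₀ w v n) := by
  induction n with
  | zero =>
    rw [show kalmanFilter a s₀ r f x₀ w v 0 = _ from funext (kalmanFilter_zero a s₀ r f x₀ w v)]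
    exact (h 0 le_rfl).const_mul _
  | succ n ih =>
    have h' : ∀ i ≤ n, Measurable[m] (obs a f x₀ w v i) := fun i hi => h i (by omega)
    rw [show kalmanFilter a s₀ r f x₀ w v (n + 1) = _ from
      funext (kalmanFilter_succ_of_obs a s₀ r f x₀ w v n)]
    have h1 := ((ih h').const_mul a).add (measurable_control_of_obs h')
    exact h1.add (((h _ le_rfl).sub h1).const_mul _)

theorem measurable_obs_innovInfo (n : ℕ) :
    ∀ i ≤ n, Measurable[innovInfo a s₀ r x₀ w v n] (obs a f x₀ w v i) := by
  induction n with
  | zero =>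
    intro i hi
    obtain rfl : i = 0 := by omega
    rw [show obs a f x₀ w v 0 = _ from funext (obs_zero a s₀ r f x₀ w v)]
    exact measurable_innov le_rfl
  | succ n ih =>
    intro i hi
    rcases hi.lt_or_eq with hi | rfl
    · exact (ih i (by omega)).mono (innovInfo_mono n.le_succ) le_rfl
    · rw [show obs a f x₀ w v (n + 1) = _ from funext (obs_succ a s₀ r f x₀ w v n)]
      have h1 := ((measurable_kalmanFilter_of_obs (s₀ := s₀) (r := r) ih).const_mul a).add
        (measurable_control_of_obs ih)
      exact (h1.mono (innovInfo_mono n.le_succ) le_rfl).add (measurable_innov le_rfl)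

theorem measurable_control_innovInfo (n : ℕ) :
    Measurable[innovInfo a s₀ r x₀ w v n] (control a f x₀ w v n) :=
  measurable_control_of_obs (measurable_obs_innovInfo n)

theorem measurable_kalmanFilter_innovInfo (n : ℕ) :
    Measurable[innovInfo a s₀ r x₀ w v n] (kalmanFilter a s₀ r f x₀ w v n) :=
  measurable_kalmanFilter_of_obs (measurable_obs_innovInfo n)

theorem measurable_kalmanFilter_info (n : ℕ) :
    Measurable[info a f x₀ w v n] (kalmanFilter a s₀ r f x₀ w v n) := by
  refine measurable_kalmanFilter_of_obs fun i hi => ?_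
  rw [measurable_iff_comap_le]
  exact (le_iSup₂_of_le (f := fun i (_ : i ∈ Finset.range (n + 1)) =>
    MeasurableSpace.comap (obs a f x₀ w v i) inferInstance) i
    (Finset.mem_range.2 (by omega)) le_rfl).trans le_sup_left

/-- The controls carry no information beyond the innovations. -/
theorem info_le_innovInfo (n : ℕ) : info a f x₀ w v n ≤ innovInfo a s₀ r x₀ w v n := by
  refine sup_le (iSup₂_le fun i hi => ?_) (iSup₂_le fun i hi => ?_)
  · exact (measurable_obs_innovInfo n i (by have := Finset.mem_range.1 hi; omega)).comap_le
  · exact ((measurable_control_innovInfo i).mono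
      (innovInfo_mono (Finset.mem_range.1 hi).le) le_rfl).comap_le

end Pathwise

variable {Ω : Type*} [mΩ : MeasurableSpace Ω] {μ : Measure Ω}
  {σ₀ σᵥ : ℝ≥0} {a : ℝ} {f : CausalStrategy} {x₀ : Ω → ℝ} {w v : ℕ → Ω → ℝ}
  (h : IsNoise μ σ₀ σᵥ x₀ w v)

section
include h

theorem IsNoise.measurable_kalmanFilter (n : ℕ) :
    Measurable (kalmanFilter a (σ₀ ^ 2) (σᵥ ^ 2) f x₀ w v n) :=
  (measurable_kalmanFilter_innovInfo n).mono (h.innovInfo_le _ _ _ n) le_rfl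

theorem IsNoise.measurable_control (n : ℕ) : Measurable (control a f x₀ w v n) :=
  (measurable_control_innovInfo n).mono (h.innovInfo_le a (σ₀ ^ 2) (σᵥ ^ 2) n) le_rfl

theorem IsNoise.memLp_state_iff (n : ℕ) : MemLp (state a f x₀ w v n) 2 μ ↔
    MemLp (kalmanFilter a (σ₀ ^ 2) (σᵥ ^ 2) f x₀ w v n) 2 μ := by
  have hm := h.memLp_comb (err a (σ₀ ^ 2) (σᵥ ^ 2) n)
  refine ⟨fun hs => hs.sub hm, fun hs => ?_⟩
  rw [show state a f x₀ w v n = _ from funext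
    (state_eq_kalmanFilter_add a (σ₀ ^ 2) (σᵥ ^ 2) f x₀ w v n)]
  exact hm.add hs

variable [IsProbabilityMeasure μ]

theorem IsNoise.secondMoment_comb (c : Unit ⊕ ℕ ⊕ ℕ →₀ ℝ) :
    secondMoment μ (comb x₀ w v c) = ENNReal.ofReal (h.cov c c) := by
  rw [secondMoment_eq_ofReal (h.memLp_comb c), h.cov_apply,
    covariance_self (h.measurable_comb c).aemeasurable,
    variance_of_integral_eq_zero (h.measurable_comb c).aemeasurable (h.integral_comb c)]

theorem IsNoise.indepFun_err {n : ℕ} {Y : Ω → ℝ}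
    (hY : Measurable[innovInfo a (σ₀ ^ 2) (σᵥ ^ 2) x₀ w v n] Y) :
    IndepFun (comb x₀ w v (err a (σ₀ ^ 2) (σᵥ ^ 2) n)) Y μ :=
  (IndepFun_iff_Indep _ _ _).2 <| indep_of_indep_of_le_right
    (h.indep_innovInfo fun _ hi => (h.cov_err_innov a hi).1) hY.comap_le

theorem IsNoise.secondMoment_state (n : ℕ) :
    secondMoment μ (state a f x₀ w v n) = ENNReal.ofReal (errVar a (σ₀ ^ 2) (σᵥ ^ 2) n) +
      secondMoment μ (kalmanFilter a (σ₀ ^ 2) (σᵥ ^ 2) f x₀ w v n) := by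
  rw [← h.cov_err_self, ← h.secondMoment_comb, ← secondMoment_add_of_indepFun (h.memLp_comb _)
    (h.integral_comb _) (h.measurable_kalmanFilter n).aestronglyMeasurable
    (h.indepFun_err (measurable_kalmanFilter_innovInfo n))]
  exact congrArg _ (funext (state_eq_kalmanFilter_add a _ _ f x₀ w v n))

/-- One step of the filter: the second moment grows by the variance of the correction, which is
the decrease of the error variance due to the new observation. -/
theorem IsNoise.secondMoment_kalmanFilter_succ (n : ℕ) :
    secondMoment μ (kalmanFilter a (σ₀ ^ 2) (σᵥ ^ 2) f x₀ w v (n + 1)) =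
      ENNReal.ofReal (predVar a (σ₀ ^ 2) (σᵥ ^ 2) (n + 1) - errVar a (σ₀ ^ 2) (σᵥ ^ 2) (n + 1)) +
      secondMoment μ fun ω => a * kalmanFilter a (σ₀ ^ 2) (σᵥ ^ 2) f x₀ w v n ω +
        control a f x₀ w v n ω := by
  set s₀ : ℝ := σ₀ ^ 2
  set r : ℝ := σᵥ ^ 2
  have hg := gain_mul_add (a := a) (sq_nonneg (σ₀ : ℝ)) (sq_nonneg (σᵥ : ℝ)) (n + 1)
  have he := errVar_eq (a := a) (sq_nonneg (σ₀ : ℝ)) (sq_nonneg (σᵥ : ℝ)) (n + 1)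
  have hq : h.cov (gain a s₀ r (n + 1) • innov a s₀ r (n + 1))
      (gain a s₀ r (n + 1) • innov a s₀ r (n + 1)) =
      predVar a s₀ r (n + 1) - errVar a s₀ r (n + 1) := by
    rw [map_smul, map_smul, LinearMap.smul_apply, h.cov_innov_self, smul_eq_mul, smul_eq_mul, he,
      hg]
    ring
  have hY : Measurable[innovInfo a s₀ r x₀ w v n] fun ω =>
      a * kalmanFilter a s₀ r f x₀ w v n ω + control a f x₀ w v n ω :=
    ((measurable_kalmanFilter_innovInfo n).const_mul a).add (measurable_control_innovInfo n)
  have hind : IndepFun (comb x₀ w v (gain a s₀ r (n + 1) • innov a s₀ r (n + 1)))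
      (fun ω => a * kalmanFilter a s₀ r f x₀ w v n ω + control a f x₀ w v n ω) μ := by
    refine (IndepFun_iff_Indep _ _ _).2 <| indep_of_indep_of_le_right
      (h.indep_innovInfo fun _ hi => ?_) hY.comap_le
    rw [map_smul, LinearMap.smul_apply, (h.cov_err_innov a hi).2, smul_zero]
  rw [← hq, ← h.secondMoment_comb, ← secondMoment_add_of_indepFun (h.memLp_comb _)
    (h.integral_comb _) (hY.mono (h.innovInfo_le _ _ _ n) le_rfl).aestronglyMeasurable hind]
  refine congrArg _ (funext fun ω => ?_)
  rw [kalmanFilter_succ, map_smul]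
  rfl

theorem IsNoise.estimate_ae_eq {n : ℕ} (hs : MemLp (state a f x₀ w v n) 2 μ) :
    estimate a f x₀ w v μ n =ᵐ[μ] kalmanFilter a (σ₀ ^ 2) (σᵥ ^ 2) f x₀ w v n := by
  have hle : info a f x₀ w v n ≤ innovInfo a (σ₀ ^ 2) (σᵥ ^ 2) x₀ w v n := info_le_innovInfo n
  have hle' : info a f x₀ w v n ≤ mΩ := hle.trans (h.innovInfo_le _ _ _ n)
  have hK := ((h.memLp_state_iff n).1 hs).integrable one_le_two
  have hE := (h.memLp_comb (err a (σ₀ ^ 2) (σᵥ ^ 2) n)).integrable one_le_two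
  have h1 : μ[comb x₀ w v (err a (σ₀ ^ 2) (σᵥ ^ 2) n) | info a f x₀ w v n] =ᵐ[μ] fun _ => 0 := by
    have := condExp_indep_eq (h.measurable_comb (err a (σ₀ ^ 2) (σᵥ ^ 2) n)).comap_le hle'
      (comap_measurable _).stronglyMeasurable (indep_of_indep_of_le_right
        (h.indep_innovInfo fun _ hi => (h.cov_err_innov a hi).1) hle)
    simpa only [h.integral_comb] using this
  have h2 : state a f x₀ w v n = comb x₀ w v (err a (σ₀ ^ 2) (σᵥ ^ 2) n) +
      kalmanFilter a (σ₀ ^ 2) (σᵥ ^ 2) f x₀ w v n :=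
    funext (state_eq_kalmanFilter_add a _ _ f x₀ w v n)
  have h3 := condExp_add hE hK (info a f x₀ w v n)
  rw [← h2, condExp_of_stronglyMeasurable hle'
    (measurable_kalmanFilter_info n).stronglyMeasurable hK] at h3
  filter_upwards [h1, h3] with ω h4 h5
  rw [estimate, h5, Pi.add_apply, h4, zero_add]

end

/-! ### Linear strategies -/

section Linear

variable [IsProbabilityMeasure μ]

/-- A law that feeds back `-k` times the filter output, as long as the state is square
integrable, keeps the state square integrable. -/
theorem IsNoise.memLp_of_linear {k : ℝ} (h : IsNoise μ σ₀ σᵥ x₀ w v)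
    (hu : ∀ n, MemLp (state a f x₀ w v n) 2 μ → control a f x₀ w v n =ᵐ[μ]
      fun ω => -k * kalmanFilter a (σ₀ ^ 2) (σᵥ ^ 2) f x₀ w v n ω) (n : ℕ) :
    MemLp (state a f x₀ w v n) 2 μ ∧
      secondMoment μ (kalmanFilter a (σ₀ ^ 2) (σᵥ ^ 2) f x₀ w v (n + 1)) =
      ENNReal.ofReal (predVar a (σ₀ ^ 2) (σᵥ ^ 2) (n + 1) - errVar a (σ₀ ^ 2) (σᵥ ^ 2) (n + 1)) +
      ENNReal.ofReal ((a - k) ^ 2) *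
        secondMoment μ (kalmanFilter a (σ₀ ^ 2) (σᵥ ^ 2) f x₀ w v n) := by
  have hstep : ∀ n, MemLp (state a f x₀ w v n) 2 μ →
      secondMoment μ (kalmanFilter a (σ₀ ^ 2) (σᵥ ^ 2) f x₀ w v (n + 1)) =
      ENNReal.ofReal (predVar a (σ₀ ^ 2) (σᵥ ^ 2) (n + 1) - errVar a (σ₀ ^ 2) (σᵥ ^ 2) (n + 1)) +
      ENNReal.ofReal ((a - k) ^ 2) *
        secondMoment μ (kalmanFilter a (σ₀ ^ 2) (σᵥ ^ 2) f x₀ w v n) := by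
    intro n hs
    rw [h.secondMoment_kalmanFilter_succ, ← secondMoment_const_mul]
    congr 1
    refine secondMoment_congr ((hu n hs).mono fun ω hω => ?_)
    simp only [hω]
    ring
  have hmem : ∀ n, MemLp (state a f x₀ w v n) 2 μ := by
    intro n
    induction n with
    | zero => exact (h.hasGaussianLaw_noise (.inl ())).memLp_two
    | succ n ih =>
      rw [h.memLp_state_iff,
        memLp_two_iff_secondMoment (h.measurable_kalmanFilter _).aestronglyMeasurable, hstep n ih]
      have h1 := (memLp_two_iff_secondMoment (h.measurable_kalmanFilter n).aestronglyMeasurable).1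
        ((h.memLp_state_iff n).1 ih)
      exact ENNReal.add_ne_top.2
        ⟨ENNReal.ofReal_ne_top, ENNReal.mul_ne_top ENNReal.ofReal_ne_top h1⟩
  exact ⟨hmem n, hstep n (hmem n)⟩

/-- The filter run under the feedback `-k` times its own output, as a function of the
observations. -/
noncomputable def filterLaw (a k s₀ r : ℝ) : (n : ℕ) → (Fin (n + 1) → ℝ) → ℝ
  | 0, y => gain a s₀ r 0 * y 0
  | n + 1, y => (a - k) * filterLaw a k s₀ r n (Fin.init y) +
      gain a s₀ r (n + 1) * (y (Fin.last _) - (a - k) * filterLaw a k s₀ r n (Fin.init y))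

theorem measurable_filterLaw (a k s₀ r : ℝ) (n : ℕ) : Measurable (filterLaw a k s₀ r n) := by
  induction n with
  | zero => exact (measurable_pi_apply _).const_mul _
  | succ n ih =>
    have h1 : Measurable fun y : Fin (n + 2) → ℝ => (a - k) * filterLaw a k s₀ r n (Fin.init y) :=
      (ih.comp (measurable_pi_lambda _ fun i => measurable_pi_apply _)).const_mul _
    exact h1.add (((measurable_pi_apply _).sub h1).const_mul _)

/-- The linear strategy with gain `k`. -/
noncomputable def linearStrategy (a k s₀ r : ℝ) : CausalStrategy where
  law n y := -k * filterLaw a k s₀ r n y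
  measurable_law n := (measurable_filterLaw a k s₀ r n).const_mul _

theorem control_linearStrategy {Ω : Type*} (a k s₀ r : ℝ) (x₀ : Ω → ℝ) (w v : ℕ → Ω → ℝ) (n : ℕ)
    (ω : Ω) :
    control a (linearStrategy a k s₀ r) x₀ w v n ω =
      -k * kalmanFilter a s₀ r (linearStrategy a k s₀ r) x₀ w v n ω := by
  change -k * filterLaw a k s₀ r n _ = _
  congr 1
  induction n with
  | zero => rw [kalmanFilter_zero]; rfl
  | succ n ih =>
    have hc : control a (linearStrategy a k s₀ r) x₀ w v n ω =
        -k * kalmanFilter a s₀ r (linearStrategy a k s₀ r) x₀ w v n ω := by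
      rw [← ih]
      rfl
    have hi : filterLaw a k s₀ r n (Fin.init fun i : Fin (n + 2) =>
        obs a (linearStrategy a k s₀ r) x₀ w v i ω) =
        kalmanFilter a s₀ r (linearStrategy a k s₀ r) x₀ w v n ω := ih
    rw [kalmanFilter_succ_of_obs, hc, filterLaw, hi, Fin.val_last]
    ring

theorem IsNoise.exists_isLinearStrategy (h : IsNoise μ σ₀ σᵥ x₀ w v) (a k : ℝ) :
    ∃ f : CausalStrategy, IsLinearStrategy a f x₀ w v μ k := by
  refine ⟨linearStrategy a k (σ₀ ^ 2) (σᵥ ^ 2), fun n => ?_⟩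
  have hu := control_linearStrategy a k (σ₀ ^ 2) (σᵥ ^ 2) x₀ w v
  have hs := (h.memLp_of_linear (fun n _ => ae_of_all _ (hu n)) n).1
  filter_upwards [h.estimate_ae_eq hs] with ω hω
  rw [hu, hω]

theorem IsNoise.tendsto_and_achieves_of_isLinearStrategy (h : IsNoise μ σ₀ σᵥ x₀ w v) {k : ℝ}
    (hk : |a - k| < 1) (hf : IsLinearStrategy a f x₀ w v μ k) :
    Tendsto (fun n => secondMoment μ fun ω =>
      state a f x₀ w v n ω - estimate a f x₀ w v μ n ω) atTop
        (𝓝 (ENNReal.ofReal (kalmanError a σᵥ))) ∧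
    Achieves μ a f x₀ w v (ENNReal.ofReal (linDistortion a σᵥ k))
      (ENNReal.ofReal (linPower a σᵥ k)) := by
  set s₀ : ℝ := σ₀ ^ 2
  set r : ℝ := σᵥ ^ 2
  have hs₀ : 0 ≤ s₀ := sq_nonneg _
  have hr : 0 ≤ r := sq_nonneg _
  have hu : ∀ n, MemLp (state a f x₀ w v n) 2 μ → control a f x₀ w v n =ᵐ[μ]
      fun ω => -k * kalmanFilter a s₀ r f x₀ w v n ω := fun n hs => by
    filter_upwards [hf n, h.estimate_ae_eq hs] with ω h1 h2
    rw [h1, h2]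
  have hmem := fun n => (h.memLp_of_linear hu n).1
  have hstep := fun n => (h.memLp_of_linear hu n).2
  set X : ℕ → ℝ := fun n => (secondMoment μ (kalmanFilter a s₀ r f x₀ w v n)).toReal
  have hX : ∀ n, secondMoment μ (kalmanFilter a s₀ r f x₀ w v n) = ENNReal.ofReal (X n) :=
    fun n => (ENNReal.ofReal_toReal ((memLp_two_iff_secondMoment
      (h.measurable_kalmanFilter n).aestronglyMeasurable).1
        ((h.memLp_state_iff n).1 (hmem n)))).symm
  have hX0 : ∀ n, 0 ≤ X n := fun n => ENNReal.toReal_nonneg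
  have hqn : ∀ n, 0 ≤ predVar a s₀ r (n + 1) - errVar a s₀ r (n + 1) := fun n => by
    have hp := predVar_nonneg (a := a) hs₀ hr (n + 1)
    rw [errVar_eq hs₀ hr, show ∀ g M : ℝ, M - (1 - g) * M = g * M by intros; ring]
    exact mul_nonneg (div_nonneg hp (add_nonneg hp hr)) hp
  have hXs : ∀ n, X (n + 1) =
      (a - k) ^ 2 * X n + (predVar a s₀ r (n + 1) - errVar a s₀ r (n + 1)) := fun n => by
    have h1 := hstep n
    rw [hX, hX, ← ENNReal.ofReal_mul (sq_nonneg _),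
      ← ENNReal.ofReal_add (hqn n) (mul_nonneg (sq_nonneg _) (hX0 n)),
      ENNReal.ofReal_eq_ofReal_iff (hX0 _)
        (add_nonneg (hqn n) (mul_nonneg (sq_nonneg _) (hX0 n)))] at h1
    rw [h1, add_comm]
  have hXlim := tendsto_of_eq_mul_add (sq_nonneg (a - k)) ((sq_lt_one_iff_abs_lt_one _).2 hk) hXs
    (tendsto_predVar_sub_errVar a σᵥ hs₀)
  have hE := tendsto_errVar a σᵥ hs₀
  refine ⟨?_, le_of_eq ?_, le_of_eq ?_⟩
  · refine (ENNReal.tendsto_ofReal hE).congr fun n => ?_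
    rw [← h.cov_err_self, ← h.secondMoment_comb]
    refine secondMoment_congr ((h.estimate_ae_eq (hmem n)).mono fun ω hω => ?_)
    simp [hω, kalmanFilter]
  · rw [linDistortion_eq _ hk]
    refine averageCost_of_tendsto (fun n => add_nonneg (errVar_nonneg hs₀ hr n) (hX0 n))
      (fun n => ?_) (hE.add hXlim)
    rw [h.secondMoment_state, hX, ENNReal.ofReal_add (errVar_nonneg hs₀ hr n) (hX0 n)]
  · rw [linPower_eq _ hk]
    refine averageCost_of_tendsto (fun n => mul_nonneg (sq_nonneg k) (hX0 n))
      (fun n => ?_) (hXlim.const_mul _)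
    rw [secondMoment_congr (hu n (hmem n)), secondMoment_const_mul, neg_sq, hX,
      ENNReal.ofReal_mul (sq_nonneg k)]

end Linear

/-! ### Optimality -/

section Converse

variable [IsProbabilityMeasure μ]

theorem IsNoise.exists_gain_of_achieves (h : IsNoise μ σ₀ σᵥ x₀ w v) {D P : ℝ≥0}
    (hf : Achieves μ a f x₀ w v D P) :
    ∃ k : ℝ, |a - k| < 1 ∧ linDistortion a σᵥ k ≤ D ∧ linPower a σᵥ k ≤ P := by
  obtain ⟨hD, hP⟩ := hf
  set s₀ : ℝ := σ₀ ^ 2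
  set r : ℝ := σᵥ ^ 2
  have hs₀ : 0 ≤ s₀ := sq_nonneg _
  have hr : 0 ≤ r := sq_nonneg _
  have hξ : ∀ n, secondMoment μ (kalmanFilter a s₀ r f x₀ w v (n + 1)) ≠ ∞ := fun n => by
    have h1 := secondMoment_ne_top_of_averageCost_le hD n
    rw [h.secondMoment_state] at h1
    exact (ENNReal.add_ne_top.1 h1).2
  have hξ2 : ∀ n, MemLp (kalmanFilter a s₀ r f x₀ w v (n + 1)) 2 μ := fun n =>
    (memLp_two_iff_secondMoment (h.measurable_kalmanFilter _).aestronglyMeasurable).2 (hξ n)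
  have hu2 : ∀ n, MemLp (control a f x₀ w v (n + 1)) 2 μ := fun n =>
    (memLp_two_iff_secondMoment (h.measurable_control _).aestronglyMeasurable).2
      (secondMoment_ne_top_of_averageCost_le hP n)
  have hE := (tendsto_add_atTop_iff_nat 1).2 (tendsto_errVar a σᵥ hs₀)
  obtain ⟨X, U, hX, hU, hXD, hUP, hstat⟩ := exists_stationary (a := a)
    (D := D - kalmanError a σᵥ) (P := P)
    (X := fun n => (secondMoment μ (kalmanFilter a s₀ r f x₀ w v (n + 1))).toReal)
    (U := fun n => (secondMoment μ (control a f x₀ w v (n + 1))).toReal)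
    (fun _ => ENNReal.toReal_nonneg) (fun _ => ENNReal.toReal_nonneg)
    ((tendsto_add_atTop_iff_nat 1).2 (tendsto_predVar_sub_errVar a σᵥ hs₀))
    (fun n t ht => by
      have hsum : MemLp (fun ω => a * kalmanFilter a s₀ r f x₀ w v (n + 1) ω +
          control a f x₀ w v (n + 1) ω) 2 μ := ((hξ2 n).const_mul a).add (hu2 n)
      rw [h.secondMoment_kalmanFilter_succ (n + 1), ENNReal.toReal_add ENNReal.ofReal_ne_top
        ((memLp_two_iff_secondMoment hsum.1).1 hsum)]
      have h1 := le_toReal_secondMoment_add (hξ2 n) (hu2 n) a ht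
      have h2 : predVar a s₀ r (n + 1 + 1) - errVar a s₀ r (n + 1 + 1) ≤ (ENNReal.ofReal
          (predVar a s₀ r (n + 1 + 1) - errVar a s₀ r (n + 1 + 1))).toReal := by
        rw [ENNReal.toReal_ofReal']
        exact le_max_left _ _
      linarith)
    (fun ε hε => by
      -- The average of the state moments is that of the filter moments plus that of `errVar`.
      filter_upwards [eventually_average_le hD (half_pos hε),
        hE.cesaro.eventually (eventually_ge_nhds (sub_lt_self _ (half_pos hε)))] with N h1 h2
      have h3 : ∀ i, (secondMoment μ (state a f x₀ w v (i + 1))).toReal =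
          errVar a s₀ r (i + 1) +
            (secondMoment μ (kalmanFilter a s₀ r f x₀ w v (i + 1))).toReal := fun i => by
        rw [h.secondMoment_state, ENNReal.toReal_add ENNReal.ofReal_ne_top (hξ i),
          ENNReal.toReal_ofReal (errVar_nonneg hs₀ hr _)]
      simp_rw [h3] at h1
      rw [Finset.sum_add_distrib, add_div] at h1
      rw [inv_mul_eq_div] at h2
      linarith)
    (fun ε hε => eventually_average_le hP hε)
  obtain ⟨k, hk, h1, h2⟩ := exists_gain_of_stationary (steadyGain_pos a σᵥ) hX hU hstat
  refine ⟨k, hk, ?_, ?_⟩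
  · rw [linDistortion_eq _ hk]
    linarith
  · rw [linPower_eq _ hk]
    exact h2.trans hUP

theorem IsNoise.linDistortion_le_averageCost (h : IsNoise μ σ₀ σᵥ x₀ w v) {k : ℝ}
    (hk : |a - k| < 1) (hka : |k| ≤ |a|) (hk0 : 0 ≤ a * k) (hk1 : a ^ 2 - 1 ≤ a * k)
    (hP : averageCost μ (control a f x₀ w v) ≤ ENNReal.ofReal (linPower a σᵥ k)) :
    ENNReal.ofReal (linDistortion a σᵥ k) ≤ averageCost μ (state a f x₀ w v) := by
  by_contra! hlt
  have hfin : averageCost μ (state a f x₀ w v) ≠ ∞ := (hlt.trans ENNReal.ofReal_lt_top).ne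
  obtain ⟨k', hk', hD', hP'⟩ := h.exists_gain_of_achieves
    (D := (averageCost μ (state a f x₀ w v)).toNNReal) (P := (linPower a σᵥ k).toNNReal)
    ⟨(ENNReal.coe_toNNReal hfin).ge, hP⟩
  rw [Real.coe_toNNReal _ (linPower_nonneg _ hk), linPower_eq _ hk, linPower_eq _ hk'] at hP'
  have h1 := distortion_le_of_power_le (steadyGain_pos a σᵥ) hk hka hk0 hk1 hk' hP'
  have h2 : linDistortion a σᵥ k ≤ linDistortion a σᵥ k' := by
    rw [linDistortion_eq _ hk, linDistortion_eq _ hk']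
    linarith
  exact hlt.not_ge ((ENNReal.ofReal_le_of_le_toReal (h2.trans hD')))

end Converse

end Control

end ScalarLQG

theorem mainTheorem12 {Ω : Type*} [MeasurableSpace Ω] (μ : Measure Ω) [IsProbabilityMeasure μ]
    (a : ℝ) (σ₀ σᵥ : ℝ≥0) (x₀ : Ω → ℝ) (w v : ℕ → Ω → ℝ)
    (hnoise : ScalarLQG.IsNoise μ σ₀ σᵥ x₀ w v) :
    -- the Riccati equation
    (0 ≤ ScalarLQG.kalmanError a σᵥ ∧
      a ^ 2 * ScalarLQG.kalmanError a σᵥ ^ 2 =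
        ((a ^ 2 - 1) * (σᵥ : ℝ) ^ 2 - 1) * ScalarLQG.kalmanError a σᵥ + (σᵥ : ℝ) ^ 2) ∧
    -- the linear strategies exist, have the steady-state error, and achieve the tradeoff
    (∀ k : ℝ, |a - k| < 1 →
      (∃ f : ScalarLQG.CausalStrategy, ScalarLQG.IsLinearStrategy a f x₀ w v μ k) ∧
      ∀ f : ScalarLQG.CausalStrategy, ScalarLQG.IsLinearStrategy a f x₀ w v μ k →
        Tendsto (fun n => ScalarLQG.secondMoment μ fun ω =>
            ScalarLQG.state a f x₀ w v n ω - ScalarLQG.estimate a f x₀ w v μ n ω)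
          atTop (𝓝 (ENNReal.ofReal (ScalarLQG.kalmanError a σᵥ))) ∧
        ScalarLQG.Achieves μ a f x₀ w v
          (ENNReal.ofReal (ScalarLQG.linDistortion a σᵥ k))
          (ENNReal.ofReal (ScalarLQG.linPower a σᵥ k))) ∧
    -- optimality: a pair achieved by any causal strategy is dominated by a linear one
    (∀ (f : ScalarLQG.CausalStrategy) (D P : ℝ≥0), ScalarLQG.Achieves μ a f x₀ w v D P →
      ∃ k : ℝ, |a - k| < 1 ∧
        ScalarLQG.linDistortion a σᵥ k ≤ D ∧ ScalarLQG.linPower a σᵥ k ≤ P) ∧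
    -- optimality of the individual pairs on the efficient branch of the curve
    (∀ k : ℝ, |a - k| < 1 → |k| ≤ |a| → 0 ≤ a * k → a ^ 2 - 1 ≤ a * k →
      ∀ f : ScalarLQG.CausalStrategy,
        ScalarLQG.averageCost μ (ScalarLQG.control a f x₀ w v) ≤
            ENNReal.ofReal (ScalarLQG.linPower a σᵥ k) →
          ENNReal.ofReal (ScalarLQG.linDistortion a σᵥ k) ≤
            ScalarLQG.averageCost μ (ScalarLQG.state a f x₀ w v)) := by
  exact ⟨⟨ScalarLQG.kalmanError_nonneg a σᵥ, ScalarLQG.kalmanError_riccati a σᵥ⟩,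
    fun k hk => ⟨hnoise.exists_isLinearStrategy a k,
      fun _ hf => hnoise.tendsto_and_achieves_of_isLinearStrategy hk hf⟩,
    fun _ _ _ hf => hnoise.exists_gain_of_achieves hf,
    fun _ hk hka hk0 hk1 _ hP => hnoise.linDistortion_le_averageCost hk hka hk0 hk1 hP⟩
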